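/- Let $R$ be a complex Banach space with a continuous conjugate-linear involution $r\mapsto r^*$ (for example $R=\mathbb{C}$, a $C^*$-algebra, or a closed self-adjoint space of bounded operators on a Hilbert space). Identify $M_n(\mathbb{C})\otimes R$ with the $n\times n$ matrices with entries in $R$, with the involution $(M^*)_{ij}=(M_{ji})^*$, and write $\mathrm{Re}\,M=\tfrac12(M+M^*)$. For $c\in R$ and $A\in M_n(\mathbb{C})$ let $cA$ denote the matrix with entries $A_{ij}c$ (that is, $A\otimes c$). Let $$\mathbb{A}=\bigcup_{n\ge 1}\mathbb{A}_n,\qquad \mathbb{A}_n=\{X\in M_n(\mathbb{C}) : X \text{ invertible},\ \|X\|<2,\ \|X^{-1}\|<2\},$$ where $\|\cdot\|$ is the operator norm. A real free function $u$ on $\mathbb{A}$ with values in matrices over $R$ is a family of maps $u_n:\mathbb{A}_n\to M_n(\mathbb{C})\otimes R$ such that $u_{m+n}(X\oplus Y)=u_m(X)\oplus u_n(Y)$ for $X\in\mathbb{A}_m$, $Y\in\mathbb{A}_n$, and $u_n(V^*XV)=V^*u_n(X)V$ for $X\in\mathbb{A}_n$ and $V$ an $n\times n$ unitary matrix. It is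 called pluriharmonic if every value $u_n(X)$ is self-adjoint, every $u_n$ is twice continuously (real) differentiable, and $$\frac{\partial^2}{\partial\bar z\,\partial z}\,u_n(X+zH)\Big|_{z=0}=0\qquad\text{for all } n,\ X\in\mathbb{A}_n,\ H\in M_n(\mathbb{C}).$$ Then for every pluriharmonic free function $u$ on $\mathbb{A}$ there are coefficients $c_k\in R$ $(k\in\mathbb{Z})$ such that, for all $n$ and all $X\in\mathbb{A}_n$, the series $\sum_{k\in\mathbb{Z}}c_kX^k$ converges (unconditionally) and $$u_n(X)=\mathrm{Re}\sum_{k=-\infty}^{\infty}c_kX^k .$$ -/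

import Mathlib

open scoped Matrix.Norms.L2Operator

namespace FreeNC

/-- The one-variable matrix universe: square matrices of every size. The size `0` is included only
for convenience; there is exactly one matrix of that size and it carries no information. -/
abbrev MatSet : Type := ∀ n : ℕ, Set (Matrix (Fin n) (Fin n) ℂ)

/-- A graded function on square complex matrices, sending an `n × n` matrix to an element of
`M_n(ℂ) ⊗ R`, that is, to an `n × n` matrix with entries in `R`. -/
abbrev GradedFun (R : Type*) : Type _ :=
  ∀ n : ℕ, Matrix (Fin n) (Fin n) ℂ → Matrix (Fin n) (Fin n) R

/-- The direct sum of two square matrices, with blocks `X` and `Y` on the diagonal. -/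
def directSum {R : Type*} [Zero R] {m n : ℕ} (X : Matrix (Fin m) (Fin m) R)
    (Y : Matrix (Fin n) (Fin n) R) : Matrix (Fin (m + n)) (Fin (m + n)) R :=
  Matrix.reindex finSumFinEquiv finSumFinEquiv (Matrix.fromBlocks X 0 0 Y)

/-- `V* M V` for a complex matrix `V` and a matrix `M` with entries in a complex vector space. -/
def conjBy {R : Type*} [AddCommMonoid R] [Module ℂ R] {n : ℕ} (V : Matrix (Fin n) (Fin n) ℂ)
    (M : Matrix (Fin n) (Fin n) R) : Matrix (Fin n) (Fin n) R :=
  Matrix.of fun i j => ∑ k, ∑ l, (star (V k i) * V l j) • M k l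

/-- The matrix `c A`, i.e. the element `A ⊗ c` of `M_n(ℂ) ⊗ R`. -/
def coeffMul {R : Type*} [AddCommMonoid R] [Module ℂ R] {n : ℕ} (c : R)
    (A : Matrix (Fin n) (Fin n) ℂ) : Matrix (Fin n) (Fin n) R :=
  Matrix.of fun i j => A i j • c

/-- Real free functions on `D`: graded functions that respect direct sums and unitary
conjugation. (Values outside `D` are irrelevant.) -/
structure IsRealFreeOn {R : Type*} [AddCommMonoid R] [Module ℂ R] (D : MatSet)
    (u : GradedFun R) : Prop where
  map_directSum : ∀ (m n : ℕ), ∀ X ∈ D m, ∀ Y ∈ D n,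
    u (m + n) (directSum X Y) = directSum (u m X) (u n Y)
  map_unitary : ∀ (n : ℕ), ∀ X ∈ D n, ∀ V ∈ Matrix.unitaryGroup (Fin n) ℂ,
    u n (star V * X * V) = conjBy V (u n X)

/-- The complex Hessian `∂²/∂z̄∂z u(X + z H)` at `z = 0`, a quarter of the Laplacian in the complex
variable `z`, computed entry by entry. -/
noncomputable def complexHessian {R : Type*} [NormedAddCommGroup R] [NormedSpace ℂ R] {n : ℕ}
    (u : Matrix (Fin n) (Fin n) ℂ → Matrix (Fin n) (Fin n) R)
    (X H : Matrix (Fin n) (Fin n) ℂ) : Matrix (Fin n) (Fin n) R :=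
  Matrix.of fun i j =>
    (1 / 4 : ℝ) • Laplacian.laplacian (fun z : ℂ => u (X + z • H) i j) 0

/-- Pluriharmonic free functions on `D`: self-adjoint valued real free functions that are, at each
level, twice continuously differentiable (in the real sense) with vanishing complex Hessian in
every direction. -/
structure IsPluriharmonicFreeOn {R : Type*} [NormedAddCommGroup R] [NormedSpace ℂ R]
    [StarAddMonoid R] (D : MatSet) (u : GradedFun R) : Prop where
  isRealFree : IsRealFreeOn D u
  isSelfAdjoint : ∀ (n : ℕ), ∀ X ∈ D n, IsSelfAdjoint (u n X)
  contDiffOn : ∀ (n : ℕ) (i j : Fin n), ContDiffOn ℝ 2 (fun X => u n X i j) (D n)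
  complexHessian_eq_zero : ∀ (n : ℕ), ∀ X ∈ D n, ∀ H : Matrix (Fin n) (Fin n) ℂ,
    complexHessian (u n) X H = 0

/-- The noncommutative annulus: invertible matrices `X` with `‖X‖ < 2` and `‖X⁻¹‖ < 2`, for the
operator norm on Euclidean space. -/
def annulus : MatSet := fun _ => {X | IsUnit X ∧ ‖X‖ < 2 ∧ ‖X⁻¹‖ < 2}

end FreeNC

/-! The theorem follows from producing, at each size `n`, a holomorphic `f_n` with `Re f_n = u_n`,
and then comparing it with one Laurent series.

The function `f_n` comes from a commutator identity. Differentiating `u(V* Z V) = V* u(Z) V` along a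
one-parameter unitary group with generator `A` gives `Du(Z)[ZA - AZ] = u(Z)A - A u(Z)`. At `Z = X ⊕
1`, with `A` off-diagonal, the corner of the right-hand side is `u(X) - u(1)` times a phase `w`
(`fderiv_rotation`). The phases `1` and `i` separate the complex linear and antilinear parts of
`Du`. By self-adjointness, the antilinear part of one corner is the adjoint of the linear part of
the opposite corner. Hence `holoLift` has real part `u` (`holoLift_add_star`). Pluriharmonicity
makes the complex linear part of `Du` holomorphic in the base point (`differentiableAt_holoDeriv`),
so `holoLift` is holomorphic.

The Laurent coefficients `c_k` of `f_1` on `1/2 < |z| < 2` define `g(X) = ∑ c_k X^k`. The lift `f_n`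
is not shown to respect direct sums, so `f = g` up to a constant needs an argument. On unitarily
diagonalizable matrices `Re g = u`, since `u` is free; thus `h = f - g` satisfies `h + h* = 0`
there. Along a holomorphic curve of such matrices this forces `h` to be constant, and so `h(N) =
h(1)` for every unitary `N` (`liftDiff_unitary`). For general `X = W exp(b) V*` with `b` real
diagonal, the curve `W exp(zb) V*` is unitary on the imaginary axis and equals `X` at `z = 1`; the
identity theorem gives `h(X) = h(1)` (`liftDiff_eq`). As `h(1) + h(1)* = 0`, it follows that `Re g =
Re f = u`. -/

namespace FreeNC

/-! ### Banach-valued Laurent expansion on a scalar annulus -/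

section LaurentExpansion

open Complex Metric

/-- The Laurent coefficients of `φ` computed on the circle of radius `r`. -/
noncomputable def laurentCoeff {R : Type*} [NormedAddCommGroup R] [NormedSpace ℂ R]
    (φ : ℂ → R) (r : ℝ) (k : ℤ) : R :=
  (2 * Real.pi * I : ℂ)⁻¹ • ∮ z in C(0, r), z⁻¹ • (z ^ (-k) • φ z)

section Laurent

variable {R : Type*} [NormedAddCommGroup R] [NormedSpace ℂ R] {φ : ℂ → R}

/-- Cauchy's theorem on the closed annulus between the two circles, where the integrand is
holomorphic. -/
lemma laurentCoeff_eq_of_le [CompleteSpace R]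
    (hφ : DifferentiableOn ℂ φ {z | 1 / 2 < ‖z‖ ∧ ‖z‖ < 2})
    {r s : ℝ} (hr : 1 / 2 < r) (hrs : r ≤ s) (hs : s < 2) (k : ℤ) :
    laurentCoeff φ s k = laurentCoeff φ r k := by
  have hopen : IsOpen {z : ℂ | 1 / 2 < ‖z‖ ∧ ‖z‖ < 2} :=
    (isOpen_lt continuous_const continuous_norm).inter (isOpen_lt continuous_norm continuous_const)
  have hd : ∀ z : ℂ, r ≤ ‖z‖ → ‖z‖ ≤ s → DifferentiableAt ℂ (fun z => z ^ (-k) • φ z) z := by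
    intro z h1 h2
    have hz : z ≠ 0 := by
      rintro rfl
      rw [norm_zero] at h1
      linarith
    exact (differentiableAt_zpow.2 (Or.inl hz)).smul
      (hφ.differentiableAt (hopen.mem_nhds ⟨by linarith, by linarith⟩))
  have := circleIntegral_sub_center_inv_smul_eq_of_differentiable_on_annulus_off_countable
    (c := 0) (r := r) (R := s) (by linarith) hrs (f := fun z => z ^ (-k) • φ z)
    Set.countable_empty
    (fun z hz => (hd z (by simpa using hz.2) (by simpa using hz.1)).continuousAt.continuousWithinAt)
    (fun z hz => hd z (by have := hz.1.2; simp at this; exact this.le)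
      (by have := hz.1.1; simp at this; exact this.le))
  simp only [sub_zero] at this
  rw [laurentCoeff, laurentCoeff, this]

lemma norm_laurentCoeff_le {r M : ℝ} (hr : 0 < r) (hM : ∀ z : ℂ, ‖z‖ = r → ‖φ z‖ ≤ M) (k : ℤ) :
    ‖laurentCoeff φ r k‖ ≤ M * r ^ (-k) := by
  have := circleIntegral.norm_two_pi_i_inv_smul_integral_le_of_norm_le_const (c := 0)
    (f := fun z => z⁻¹ • (z ^ (-k) • φ z)) (C := r⁻¹ * (r ^ (-k) * M)) hr.le (by
      intro z hz
      have hz' : ‖z‖ = r := by simpa using hz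
      rw [norm_smul, norm_smul, norm_inv, norm_zpow, hz']
      gcongr
      exact hM z hz')
  refine this.trans (le_of_eq ?_)
  field_simp

/-- Parametrizing the circle turns the contour integral into a Fourier integral. This transfers
convergence of the Laurent series to scalar Fourier theory. -/
lemma fourierCoeff_circle [CompleteSpace R] {r : ℝ} (hr : 0 < r)
    (hφ : ContinuousOn φ (sphere 0 r)) (l : R →L[ℂ] ℂ) (k : ℤ) :
    haveI : Fact (0 < 2 * Real.pi) := ⟨Real.two_pi_pos⟩
    fourierCoeff (T := 2 * Real.pi) (fun t => l (φ (r * (AddCircle.toCircle t : ℂ)))) k =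
      r ^ k * l (laurentCoeff φ r k) := by
  have : Fact (0 < 2 * Real.pi) := ⟨Real.two_pi_pos⟩
  have hr' : (r : ℂ) ≠ 0 := by exact_mod_cast hr.ne'
  rw [fourierCoeff_eq_intervalIntegral _ _ 0, laurentCoeff, map_smul, circleIntegral, zero_add,
    ← l.intervalIntegral_comp_comm]
  · rw [smul_eq_mul, mul_left_comm, ← intervalIntegral.integral_const_mul,
      ← intervalIntegral.integral_const_mul, Complex.real_smul,
      ← intervalIntegral.integral_const_mul]
    refine intervalIntegral.integral_congr fun θ _ => ?_
    have he : (AddCircle.toCircle (θ : AddCircle (2 * Real.pi)) : ℂ) = exp (θ * I) := by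
      rw [AddCircle.toCircle_apply_mk, Circle.coe_exp]
      congr 2
      push_cast
      field_simp
    have hf : (fourier (-k) (θ : AddCircle (2 * Real.pi)) : ℂ) = exp (θ * I) ^ (-k) := by
      rw [← he, fourier_apply, AddCircle.toCircle_zsmul, Circle.coe_zpow]
    have hexp : exp (θ * I) ≠ 0 := exp_ne_zero _
    simp only [deriv_circleMap, circleMap, zero_add, map_smul, smul_eq_mul, hf, he, mul_zpow]
    rw [zpow_neg, zpow_neg]
    have := zpow_ne_zero k hr'
    have := zpow_ne_zero k hexp
    push_cast
    field_simp
  · have hcm : ∀ θ, circleMap 0 r θ ∈ sphere (0 : ℂ) r := circleMap_mem_sphere 0 hr.le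
    have h0 : ∀ θ, circleMap 0 r θ ≠ 0 := fun θ => circleMap_ne_center hr.ne'
    have hc := continuous_circleMap 0 r
    refine Continuous.intervalIntegrable ?_ _ _
    have h1 : Continuous fun θ => φ (circleMap 0 r θ) := hφ.comp_continuous hc hcm
    have h2 : Continuous fun θ => deriv (circleMap 0 r) θ := by
      simp only [deriv_circleMap]; fun_prop
    exact h2.smul ((hc.inv₀ h0).smul ((hc.zpow₀ _ fun θ => Or.inl (h0 θ)).smul h1))

lemma summable_mul_pow_natAbs {c : ℤ → ℝ} (hc : ∀ k, 0 ≤ c k) {ρ s M : ℝ} (hρ : 0 ≤ ρ) (hs : ρ < s)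
    (h : ∀ k, c k ≤ M * s⁻¹ ^ k.natAbs) : Summable fun k : ℤ => c k * ρ ^ k.natAbs := by
  have hs0 : 0 < s := hρ.trans_lt hs
  have hg : Summable fun n : ℕ => M * (ρ / s) ^ n :=
    (summable_geometric_of_lt_one (by positivity) ((div_lt_one hs0).2 hs)).mul_left M
  have key : ∀ k : ℤ, c k * ρ ^ k.natAbs ≤ M * (ρ / s) ^ k.natAbs := by
    intro k
    calc c k * ρ ^ k.natAbs ≤ (M * s⁻¹ ^ k.natAbs) * ρ ^ k.natAbs := by
          gcongr
          exact h k
      _ = _ := by rw [div_eq_inv_mul, mul_pow]; ring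
  refine Summable.of_nat_of_neg ?_ ?_
  · exact Summable.of_nonneg_of_le (fun n => mul_nonneg (hc _) (by positivity))
      (fun n => by simpa using key n) hg
  · exact Summable.of_nonneg_of_le (fun n => mul_nonneg (hc _) (by positivity))
      (fun n => by simpa using key (-n)) hg

/-- Laurent expansion on the annulus `1/2 < |z| < 2`. -/
theorem exists_laurent [CompleteSpace R]
    (hφ : DifferentiableOn ℂ φ {z | 1 / 2 < ‖z‖ ∧ ‖z‖ < 2}) :
    ∃ c : ℤ → R, (∀ ρ : ℝ, 0 ≤ ρ → ρ < 2 → Summable fun k => ‖c k‖ * ρ ^ k.natAbs) ∧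
      ∀ z : ℂ, 1 / 2 < ‖z‖ → ‖z‖ < 2 → HasSum (fun k => z ^ k • c k) (φ z) := by
  have hindep : ∀ r : ℝ, 1 / 2 < r → r < 2 → ∀ k, laurentCoeff φ r k = laurentCoeff φ 1 k := by
    intro r h1 h2 k
    rcases le_total r 1 with h | h
    · exact (laurentCoeff_eq_of_le hφ h1 h (by norm_num) k).symm
    · exact laurentCoeff_eq_of_le hφ (by norm_num) h h2 k
  have hcont : ∀ r : ℝ, 1 / 2 < r → r < 2 → ContinuousOn φ (sphere 0 r) := fun r h1 h2 =>
    hφ.continuousOn.mono fun z hz => by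
      have : ‖z‖ = r := by simpa using hz
      exact ⟨by linarith, by linarith⟩
  have hbound : ∀ r : ℝ, 1 / 2 < r → r < 2 → ∃ M, 0 ≤ M ∧
      ∀ k, ‖laurentCoeff φ 1 k‖ ≤ M * r ^ (-k) := by
    intro r h1 h2
    obtain ⟨M, hM⟩ := (isCompact_sphere (0 : ℂ) r).exists_bound_of_continuousOn (hcont r h1 h2)
    refine ⟨max M 0, le_max_right _ _, fun k => ?_⟩
    rw [← hindep r h1 h2]
    exact norm_laurentCoeff_le (by linarith)
      (fun z hz => (hM z (by simpa using hz)).trans (le_max_left _ _)) k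
  have hsum : ∀ ρ : ℝ, 0 ≤ ρ → ρ < 2 →
      Summable fun k => ‖laurentCoeff φ 1 k‖ * ρ ^ k.natAbs := by
    intro ρ h0 h2
    -- Cauchy estimates on the radii `s` and `s⁻¹` control positive and negative `k` respectively;
    -- `1 < s < 2` puts both circles inside the annulus, and `ρ < s` leaves room for a geometric
    -- majorant.
    obtain ⟨s, hs1, hs2⟩ := exists_between (max_lt h2 (by norm_num : (1 : ℝ) < 2))
    have hρs : ρ < s := (le_max_left _ _).trans_lt hs1
    have h1s : 1 < s := (le_max_right _ _).trans_lt hs1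
    obtain ⟨M₁, hM₁, h₁⟩ := hbound s (by linarith) hs2
    obtain ⟨M₂, hM₂, h₂⟩ := hbound s⁻¹ (by
      rw [one_div]; exact inv_strictAnti₀ (by linarith) hs2) (by
      have := inv_lt_one_of_one_lt₀ h1s; linarith)
    refine summable_mul_pow_natAbs (M := max M₁ M₂) (fun k => norm_nonneg _) h0 hρs fun k => ?_
    have hpos : 0 ≤ s⁻¹ ^ k.natAbs := by positivity
    rcases le_total 0 k with hk | hk
    · obtain ⟨n, rfl⟩ := Int.eq_ofNat_of_zero_le hk
      refine (h₁ n).trans ?_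
      simp only [Int.natAbs_natCast, zpow_neg, zpow_natCast, inv_pow] at hpos ⊢
      gcongr
      exact le_max_left _ _
    · obtain ⟨n, rfl⟩ := Int.exists_eq_neg_ofNat hk
      refine (h₂ _).trans ?_
      simp only [Int.natAbs_neg, Int.natAbs_natCast, neg_neg, zpow_natCast, inv_pow] at hpos ⊢
      gcongr
      exact le_max_right _ _
  refine ⟨laurentCoeff φ 1, hsum, fun z h1 h2 => ?_⟩
  have : Fact (0 < 2 * Real.pi) := ⟨Real.two_pi_pos⟩
  set r := ‖z‖ with hr
  have hr0 : 0 < r := by linarith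
  have hsz : Summable fun k : ℤ => ‖z ^ k • laurentCoeff φ 1 k‖ := by
    have hm : max r r⁻¹ < 2 := max_lt h2 (by
      rw [inv_lt_comm₀ hr0 (by norm_num)]; linarith)
    refine Summable.of_nonneg_of_le (fun _ => norm_nonneg _) (fun k => ?_)
      (hsum (max r r⁻¹) (by positivity) hm)
    rw [norm_smul, norm_zpow, mul_comm, ← hr]
    gcongr
    rcases le_total 0 k with hk | hk
    · obtain ⟨n, rfl⟩ := Int.eq_ofNat_of_zero_le hk
      simp only [Int.natAbs_natCast, zpow_natCast]
      gcongr
      exact le_max_left _ _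
    · obtain ⟨n, rfl⟩ := Int.exists_eq_neg_ofNat hk
      simp only [Int.natAbs_neg, Int.natAbs_natCast, zpow_neg, zpow_natCast, ← inv_pow]
      gcongr
      exact le_max_right _ _
  have hS := hsz.of_norm.hasSum
  convert hS using 1
  -- Continuous functionals separate points, so it suffices to identify the sum after applying each
  -- `l`, where the series becomes the Fourier series on the circle through `z`.
  refine (SeparatingDual.eq_iff_forall_dual_eq (R := ℂ)).2 fun l => ?_
  have hlS := l.hasSum hS
  have hFc : Continuous fun t : AddCircle (2 * Real.pi) =>
      l (φ (r * (AddCircle.toCircle t : ℂ))) := by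
    refine l.continuous.comp ((hcont r h1 h2).comp_continuous ?_ fun t => ?_)
    · exact continuous_const.mul (continuous_subtype_val.comp AddCircle.continuous_toCircle)
    · rw [mem_sphere_zero_iff_norm, norm_mul, Circle.norm_coe, mul_one,
        Complex.norm_of_nonneg hr0.le]
  let F : C(AddCircle (2 * Real.pi), ℂ) := ⟨_, hFc⟩
  have hco : ∀ k, fourierCoeff F k = r ^ k * l (laurentCoeff φ 1 k) := fun k => by
    rw [← hindep r h1 h2]
    exact fourierCoeff_circle hr0 (hcont r h1 h2) l k
  have hsF : Summable (fourierCoeff F) := by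
    have : Summable fun k => ‖l‖ * ‖z ^ k • laurentCoeff φ 1 k‖ := hsz.mul_left _
    refine Summable.of_norm_bounded this fun k => ?_
    rw [hco, norm_mul, norm_smul, norm_zpow, norm_zpow, mul_left_comm, ← hr,
      Complex.norm_of_nonneg hr0.le]
    gcongr
    exact l.le_opNorm _
  let t : AddCircle (2 * Real.pi) := ((arg z : ℝ) : AddCircle (2 * Real.pi))
  have ht : (AddCircle.toCircle t : ℂ) = exp (arg z * I) := by
    rw [AddCircle.toCircle_apply_mk, Circle.coe_exp]
    congr 2
    push_cast
    field_simp
  have hz : (r : ℂ) * AddCircle.toCircle t = z := by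
    rw [ht, hr, Complex.norm_mul_exp_arg_mul_I]
  have := has_pointwise_sum_fourier_series_of_summable hsF t
  have hFt : F t = l (φ z) := by
    change l (φ (r * (AddCircle.toCircle t : ℂ))) = _
    rw [hz]
  rw [hFt] at this
  refine this.unique ?_
  have hterm : ∀ k, l (z ^ k • laurentCoeff φ 1 k) = fourierCoeff F k • fourier k t := by
    intro k
    rw [hco, map_smul, fourier_apply, AddCircle.toCircle_zsmul, Circle.coe_zpow,
      smul_eq_mul, smul_eq_mul, mul_right_comm, ← mul_zpow, hz]
  simpa only [hterm] using hlS

end Laurent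

end LaurentExpansion

/-! ### The complex linear part of the derivative is holomorphic -/

section HolomorphicPart

variable {E R : Type*} [NormedAddCommGroup E] [NormedSpace ℂ E]
  [NormedAddCommGroup R] [NormedSpace ℂ R]

/-- The complex linear part of the real derivative of `u` at `X`, in direction `H`. -/
noncomputable def holoDeriv (u : E → R) (X H : E) : R :=
  (1 / 2 : ℂ) • (fderiv ℝ u X H - Complex.I • fderiv ℝ u X (Complex.I • H))

lemma laplacian_slice {u : E → R} {s : Set E} (hs : IsOpen s) (hu : ContDiffOn ℝ 2 u s) {X : E}
    (hX : X ∈ s) (H : E) :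
    Laplacian.laplacian (fun z : ℂ => u (X + z • H)) 0 =
      fderiv ℝ (fderiv ℝ u) X H H +
        fderiv ℝ (fderiv ℝ u) X (Complex.I • H) (Complex.I • H) := by
  let A : ℂ →L[ℝ] E := (ContinuousLinearMap.toSpanSingleton ℂ H).restrictScalars ℝ
  have hA : ∀ z, A z = z • H := fun z => by simp [A]
  have hg : ∀ z, HasFDerivAt (fun z : ℂ => X + z • H) A z := fun z => by
    simpa [hA] using (A.hasFDerivAt (x := z)).const_add X
  have hsX : s ∈ nhds X := hs.mem_nhds hX
  have hev : ∀ᶠ z in nhds (0 : ℂ), X + z • H ∈ s := by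
    refine (hg 0).continuousAt.eventually_mem ?_
    simpa using hsX
  have h1 : fderiv ℝ (fun z : ℂ => u (X + z • H)) =ᶠ[nhds 0]
      fun z => (fderiv ℝ u (X + z • H)).comp A := by
    filter_upwards [hev] with z hz
    exact (((hu.contDiffAt (hs.mem_nhds hz)).differentiableAt
      (by norm_num)).hasFDerivAt.comp z (hg z)).fderiv
  have hd2 : DifferentiableAt ℝ (fderiv ℝ u) (X + (0 : ℂ) • H) := by
    rw [zero_smul, add_zero]
    exact ((hu.contDiffAt hsX).fderiv_right (m := 1) (by norm_num)).differentiableAt (by norm_num)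
  have h2 : HasFDerivAt (fun z : ℂ => (fderiv ℝ u (X + z • H)).comp A)
      (((ContinuousLinearMap.compL ℝ ℂ E R).flip A).comp
        ((fderiv ℝ (fderiv ℝ u) (X + (0 : ℂ) • H)).comp A)) 0 :=
    ((ContinuousLinearMap.compL ℝ ℂ E R).flip A).hasFDerivAt.comp (0 : ℂ)
      (hd2.hasFDerivAt.comp (0 : ℂ) (hg 0))
  have h3 := (h2.congr_of_eventuallyEq h1).fderiv
  rw [InnerProductSpace.laplacian_eq_iteratedFDeriv_complexPlane]
  simp only [iteratedFDeriv_two_apply, h3]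
  simp [hA]

/-- The vanishing Laplacians say that the second derivative `B` satisfies `B(H,H) + B(iH,iH) = 0`.
Polarizing the symmetric form gives `B(iH,iK) = -B(H,K)`, which is what makes the real derivative of
`holoDeriv` complex linear. -/
lemma differentiableAt_holoDeriv {u : E → R} {s : Set E} (hs : IsOpen s)
    (hu : ContDiffOn ℝ 2 u s)
    (hlap : ∀ X ∈ s, ∀ H : E, Laplacian.laplacian (fun z : ℂ => u (X + z • H)) 0 = 0)
    {X : E} (hX : X ∈ s) (H : E) : DifferentiableAt ℂ (fun Y => holoDeriv u Y H) X := by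
  have hc := hu.contDiffAt (hs.mem_nhds hX)
  have hd2 : DifferentiableAt ℝ (fderiv ℝ u) X :=
    (hc.fderiv_right (m := 1) (by norm_num)).differentiableAt (by norm_num)
  set B := fderiv ℝ (fderiv ℝ u) X with hB
  have hsymm : ∀ H K, B H K = B K H := fun H K =>
    (hc.isSymmSndFDerivAt (by simp)) H K
  have hQ : ∀ H, B H H + B (Complex.I • H) (Complex.I • H) = 0 := fun H => by
    rw [← laplacian_slice hs hu hX, hlap X hX]
  have hpol : ∀ H K, B (Complex.I • H) (Complex.I • K) = - B H K := by
    intro H K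
    have h1 := hQ (H + K)
    have h2 := hQ H
    have h3 := hQ K
    simp only [smul_add, map_add, _root_.add_apply] at h1
    rw [hsymm K H, hsymm (Complex.I • K) (Complex.I • H)] at h1
    -- This is the polarization `Q(H+K) - Q(H) - Q(K)` of `Q(H) = B(H,H) + B(iH,iH)`; each zero is
    -- expanded into the matching value of `Q`.
    have h4 : (2 : ℝ) • (B H K + B (Complex.I • H) (Complex.I • K)) = 0 := by
      rw [← sub_zero (0 : R), ← sub_zero (0 - 0 : R)]
      nth_rewrite 1 [← h1]
      nth_rewrite 1 [← h2]
      rw [← h3]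
      module
    have h5 := (smul_eq_zero.1 h4).resolve_left two_ne_zero
    exact (eq_neg_of_add_eq_zero_right h5)
  have hI : ∀ K, B (Complex.I • K) (Complex.I • H) = - B K H := fun K => hpol K H
  have hI' : ∀ K, B (Complex.I • K) H = B K (Complex.I • H) := fun K => by
    have := hpol K (Complex.I • H)
    rw [smul_smul, Complex.I_mul_I, neg_one_smul, map_neg, neg_inj] at this
    exact this
  have hev : ∀ v : E, HasFDerivAt (fun Y => fderiv ℝ u Y v) (B.flip v) X := fun v =>
    hd2.hasFDerivAt.clm_apply (hasFDerivAt_const v X) |>.congr_fderiv (by ext; simp [hB])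
  have hreal : HasFDerivAt (fun Y => holoDeriv u Y H)
      ((1 / 2 : ℂ) • (B.flip H - Complex.I • B.flip (Complex.I • H))) X :=
    ((hev H).sub ((hev (Complex.I • H)).const_smul Complex.I)).const_smul (1 / 2 : ℂ)
  -- Given real differentiability, complex differentiability only needs the real derivative to
  -- commute with multiplication by `i`.
  rw [differentiableAt_iff_restrictScalars ℝ hreal.differentiableAt, hreal.fderiv]
  set G := (1 / 2 : ℂ) • (B.flip H - Complex.I • B.flip (Complex.I • H)) with hG
  have hGI : ∀ K, G (Complex.I • K) = Complex.I • G K := by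
    intro K
    simp only [hG, _root_.smul_apply, _root_.sub_apply,
      ContinuousLinearMap.flip_apply, hI, hI']
    rw [smul_comm Complex.I (1 / 2 : ℂ)]
    congr 1
    rw [smul_sub, smul_smul Complex.I Complex.I, Complex.I_mul_I]
    simp [add_comm]
  refine ⟨⟨{ toFun := G, map_add' := G.map_add, map_smul' := ?_ }, G.continuous⟩, ?_⟩
  · intro c K
    have hc : c • K = c.re • K + c.im • (Complex.I • K) := by
      conv_lhs => rw [← Complex.re_add_im c]
      rw [add_smul, mul_smul]
      rfl
    rw [hc, map_add, map_smul, map_smul, hGI, RingHom.id_apply]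
    conv_rhs => rw [← Complex.re_add_im c]
    rw [add_smul, mul_smul]
    rfl
  · ext K
    rfl

end HolomorphicPart

/-! ### Calculus of 2 × 2 block matrices -/

section Blocks

variable {S : Type*} {m n : ℕ}

/-- The block matrix with blocks `A`, `B`, `C`, `D`, indexed by `Fin (m + n)`. -/
def blk (A : Matrix (Fin m) (Fin m) S) (B : Matrix (Fin m) (Fin n) S)
    (C : Matrix (Fin n) (Fin m) S) (D : Matrix (Fin n) (Fin n) S) :
    Matrix (Fin (m + n)) (Fin (m + n)) S :=
  Matrix.reindex finSumFinEquiv finSumFinEquiv (Matrix.fromBlocks A B C D)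

variable (A : Matrix (Fin m) (Fin m) S) (B : Matrix (Fin m) (Fin n) S)
    (C : Matrix (Fin n) (Fin m) S) (D : Matrix (Fin n) (Fin n) S)

lemma directSum_eq_blk [Zero S] : directSum A D = blk A 0 0 D := rfl

@[simp] lemma blk_castAdd_castAdd (i j : Fin m) :
    blk A B C D (Fin.castAdd n i) (Fin.castAdd n j) = A i j := by simp [blk]

@[simp] lemma blk_castAdd_natAdd (i : Fin m) (j : Fin n) :
    blk A B C D (Fin.castAdd n i) (Fin.natAdd m j) = B i j := by simp [blk]

@[simp] lemma blk_natAdd_castAdd (i : Fin n) (j : Fin m) :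
    blk A B C D (Fin.natAdd m i) (Fin.castAdd n j) = C i j := by simp [blk]

@[simp] lemma blk_natAdd_natAdd (i j : Fin n) :
    blk A B C D (Fin.natAdd m i) (Fin.natAdd m j) = D i j := by simp [blk]

lemma blk_ext {M N : Matrix (Fin (m + n)) (Fin (m + n)) S}
    (h11 : ∀ i j, M (Fin.castAdd n i) (Fin.castAdd n j) = N (Fin.castAdd n i) (Fin.castAdd n j))
    (h12 : ∀ i j, M (Fin.castAdd n i) (Fin.natAdd m j) = N (Fin.castAdd n i) (Fin.natAdd m j))
    (h21 : ∀ i j, M (Fin.natAdd m i) (Fin.castAdd n j) = N (Fin.natAdd m i) (Fin.castAdd n j))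
    (h22 : ∀ i j, M (Fin.natAdd m i) (Fin.natAdd m j) = N (Fin.natAdd m i) (Fin.natAdd m j)) :
    M = N := by
  ext i j
  refine Fin.addCases (fun i => ?_) (fun i => ?_) i <;>
    refine Fin.addCases (fun j => ?_) (fun j => ?_) j
  exacts [h11 i j, h12 i j, h21 i j, h22 i j]

lemma blk_mul [Ring S] (A' : Matrix (Fin m) (Fin m) S) (B' : Matrix (Fin m) (Fin n) S)
    (C' : Matrix (Fin n) (Fin m) S) (D' : Matrix (Fin n) (Fin n) S) :
    blk A B C D * blk A' B' C' D' =
      blk (A * A' + B * C') (A * B' + B * D') (C * A' + D * C') (C * B' + D * D') := by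
  simp only [blk, Matrix.reindex_apply, Matrix.submatrix_mul_equiv, Matrix.fromBlocks_multiply]

lemma star_blk [Star S] :
    star (blk A B C D) = blk A.conjTranspose C.conjTranspose B.conjTranspose D.conjTranspose := by
  refine blk_ext ?_ ?_ ?_ ?_ <;> intros <;> simp [Matrix.star_apply]

lemma blk_one [Ring S] : blk (1 : Matrix (Fin m) (Fin m) S) 0 0 (1 : Matrix (Fin n) (Fin n) S) = 1 := by
  simp [blk]

lemma blk_add [Add S] (A' : Matrix (Fin m) (Fin m) S) (B' : Matrix (Fin m) (Fin n) S)
    (C' : Matrix (Fin n) (Fin m) S) (D' : Matrix (Fin n) (Fin n) S) :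
    blk A B C D + blk A' B' C' D' = blk (A + A') (B + B') (C + C') (D + D') := by
  refine blk_ext ?_ ?_ ?_ ?_ <;> intros <;> simp

lemma blk_smul {k : Type*} [SMul k S] (c : k) :
    c • blk A B C D = blk (c • A) (c • B) (c • C) (c • D) := by
  refine blk_ext ?_ ?_ ?_ ?_ <;> intros <;> simp

end Blocks

/-! ### The annulus is open and closed under direct sums -/

section Annulus

lemma isOpen_annulus (n : ℕ) : IsOpen (annulus n) := by
  rw [isOpen_iff_mem_nhds]
  rintro X ⟨hX, h1, h2⟩
  have hinv : ContinuousAt (fun Y : Matrix (Fin n) (Fin n) ℂ => Y⁻¹) X := by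
    obtain ⟨x, rfl⟩ := hX
    have := NormedRing.inverse_continuousAt x
    have h : (fun Y : Matrix (Fin n) (Fin n) ℂ => Y⁻¹) = Ring.inverse :=
      funext Matrix.nonsing_inv_eq_ringInverse
    rwa [h]
  have h3 : ∀ᶠ Y in nhds X, IsUnit Y := Units.isOpen.mem_nhds hX
  have h4 : ∀ᶠ Y in nhds X, ‖Y‖ < 2 := continuous_norm.continuousAt.eventually_lt_const h1
  have h5 : ∀ᶠ Y in nhds X, ‖Y⁻¹‖ < 2 := hinv.norm.eventually_lt_const h2
  filter_upwards [h3, h4, h5] with Y a b c using ⟨a, b, c⟩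

lemma mem_annulus_of_mul_eq_one {n : ℕ} {X Y : Matrix (Fin n) (Fin n) ℂ} (h : X * Y = 1)
    (hX : ‖X‖ < 2) (hY : ‖Y‖ < 2) : X ∈ annulus n := by
  refine ⟨?_, hX, ?_⟩
  · exact (Matrix.isUnit_iff_isUnit_det X).2 (Matrix.isUnit_det_of_right_inverse h)
  · rwa [Matrix.inv_eq_right_inv h]

/-- Splitting a vector into its two blocks, squared norms add, and each block is stretched by at
most the larger of the two norms. -/
lemma norm_directSum_le {m n : ℕ} (X : Matrix (Fin m) (Fin m) ℂ) (Y : Matrix (Fin n) (Fin n) ℂ) :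
    ‖directSum X Y‖ ≤ max ‖X‖ ‖Y‖ := by
  rw [Matrix.cstar_norm_def]
  refine ContinuousLinearMap.opNorm_le_bound _ (by positivity) fun v => ?_
  refine le_of_sq_le_sq ?_ (by positivity)
  let v₁ : EuclideanSpace ℂ (Fin m) := WithLp.toLp 2 fun i => v (Fin.castAdd n i)
  let v₂ : EuclideanSpace ℂ (Fin n) := WithLp.toLp 2 fun i => v (Fin.natAdd m i)
  have hv : ‖v‖ ^ 2 = ‖v₁‖ ^ 2 + ‖v₂‖ ^ 2 := by
    simp [EuclideanSpace.norm_sq_eq, Fin.sum_univ_add, v₁, v₂]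
  have hw : ‖Matrix.toEuclideanCLM (n := Fin (m + n)) (𝕜 := ℂ) (directSum X Y) v‖ ^ 2 =
      ‖Matrix.toEuclideanCLM (n := Fin m) (𝕜 := ℂ) X v₁‖ ^ 2 +
      ‖Matrix.toEuclideanCLM (n := Fin n) (𝕜 := ℂ) Y v₂‖ ^ 2 := by
    simp [EuclideanSpace.norm_sq_eq, Fin.sum_univ_add, v₁, v₂, Matrix.ofLp_toEuclideanCLM,
      Matrix.mulVec, dotProduct, directSum_eq_blk]
  have h1 := (Matrix.toEuclideanCLM (n := Fin m) (𝕜 := ℂ) X).le_opNorm v₁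
  have h2 := (Matrix.toEuclideanCLM (n := Fin n) (𝕜 := ℂ) Y).le_opNorm v₂
  rw [← Matrix.cstar_norm_def] at h1 h2
  have h1' := h1.trans (mul_le_mul_of_nonneg_right (le_max_left ‖X‖ ‖Y‖) (norm_nonneg _))
  have h2' := h2.trans (mul_le_mul_of_nonneg_right (le_max_right ‖X‖ ‖Y‖) (norm_nonneg _))
  rw [hw, mul_pow, hv, mul_add, ← mul_pow, ← mul_pow]
  gcongr

lemma directSum_mem_annulus {m n : ℕ} {X : Matrix (Fin m) (Fin m) ℂ}
    {Y : Matrix (Fin n) (Fin n) ℂ} (hX : X ∈ annulus m) (hY : Y ∈ annulus n) :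
    directSum X Y ∈ annulus (m + n) := by
  refine mem_annulus_of_mul_eq_one (Y := directSum X⁻¹ Y⁻¹) ?_
    ((norm_directSum_le X Y).trans_lt (max_lt hX.2.1 hY.2.1))
    ((norm_directSum_le _ _).trans_lt (max_lt hX.2.2 hY.2.2))
  rw [directSum_eq_blk, directSum_eq_blk, blk_mul,
    Matrix.mul_nonsing_inv _ ((Matrix.isUnit_iff_isUnit_det X).1 hX.1),
    Matrix.mul_nonsing_inv _ ((Matrix.isUnit_iff_isUnit_det Y).1 hY.1)]
  simp [blk_one]

lemma one_mem_annulus (n : ℕ) : (1 : Matrix (Fin n) (Fin n) ℂ) ∈ annulus n := by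
  have h : ‖(1 : Matrix (Fin n) (Fin n) ℂ)‖ < 2 := by
    rw [← Matrix.diagonal_one, Matrix.l2_opNorm_diagonal, pi_norm_lt_iff (by norm_num)]
    simp
  exact mem_annulus_of_mul_eq_one (one_mul 1) h h

end Annulus

/-! ### The holomorphic lift -/

section Lift

variable {R : Type*} [NormedAddCommGroup R] [NormedSpace ℂ R]

/-- A holomorphic function on level `n` whose real part is `u n`, read off from the complex linear
part of the derivative of `u` at `X ⊕ 1`. -/
noncomputable def holoLift (u : GradedFun R) (n : ℕ) (X : Matrix (Fin n) (Fin n) ℂ)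
    (i j : Fin n) : R :=
  u n 1 i j +
    holoDeriv (fun Y => u (n + n) Y (Fin.castAdd n i) (Fin.natAdd n j)) (directSum X 1)
      (blk 0 (X - 1) 0 0) +
    holoDeriv (fun Y => u (n + n) Y (Fin.natAdd n i) (Fin.castAdd n j)) (directSum X 1)
      (blk 0 0 (X - 1) 0)

/-- Both sides of `u(V* Z V) = V* u(Z) V` are differentiated along rotations mixing the two summands
of `Z = X ⊕ 1`. The unit phase `w` is kept free because `w = 1` and `w = i` are both needed to
isolate the complex linear part. -/
lemma fderiv_rotation [StarAddMonoid R] {u : GradedFun R}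
    (hu : IsPluriharmonicFreeOn annulus u) {n : ℕ} {X : Matrix (Fin n) (Fin n) ℂ}
    (hX : X ∈ annulus n) {w : ℂ} (hw : star w * w = 1) (i j : Fin n) :
    fderiv ℝ (fun Y => u (n + n) Y (Fin.castAdd n i) (Fin.natAdd n j)) (directSum X 1)
      (blk 0 (w • (X - 1)) (star w • (X - 1)) 0) = w • (u n X i j - u n 1 i j) := by
  set Z := directSum X (1 : Matrix (Fin n) (Fin n) ℂ) with hZ
  have hZA : Z ∈ annulus (n + n) := directSum_mem_annulus hX (one_mem_annulus n)
  set A : Matrix (Fin (n + n)) (Fin (n + n)) ℂ :=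
    blk 0 (w • 1 : Matrix (Fin n) (Fin n) ℂ) (-(star w • 1) : Matrix (Fin n) (Fin n) ℂ) 0 with hA
  have hAs : star A = -A := by
    rw [hA, star_blk, ← neg_one_smul ℂ (blk _ _ _ _), blk_smul]
    simp [Matrix.conjTranspose_smul]
  have hAA : A * A = -1 := by
    rw [hA, blk_mul, ← neg_one_smul ℂ (1 : Matrix (Fin (n + n)) (Fin (n + n)) ℂ), ← blk_one,
      blk_smul]
    have hw' : w * star w = 1 := by rw [mul_comm]; exact hw
    simp only [Complex.star_def] at hw hw'
    simp [smul_smul, hw, hw']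
  have hZAZ : Z * A - A * Z = blk 0 (w • (X - 1)) (star w • (X - 1)) 0 := by
    rw [hZ, hA, directSum_eq_blk, blk_mul, blk_mul, sub_eq_add_neg,
      ← neg_one_smul ℂ (blk _ _ _ _), blk_smul, blk_add]
    simp [sub_eq_add_neg, add_comm]
  -- Since `A² = -1`, this is `exp(tA)`; since `A* = -A`, it is unitary.
  let V : ℝ → Matrix (Fin (n + n)) (Fin (n + n)) ℂ := fun t =>
    (Real.cos t : ℂ) • 1 + (Real.sin t : ℂ) • A
  have hVs : ∀ t, star (V t) = (Real.cos t : ℂ) • 1 - (Real.sin t : ℂ) • A := fun t => by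
    simp only [V, star_add, star_smul, hAs, star_one, Complex.star_def, Complex.conj_ofReal,
      smul_neg, sub_eq_add_neg]
  have hcs : ∀ t : ℝ, (Real.cos t : ℂ) * Real.cos t + (Real.sin t : ℂ) * Real.sin t = 1 :=
    fun t => by exact_mod_cast (by nlinarith [Real.cos_sq_add_sin_sq t])
  have hVu : ∀ t, V t ∈ Matrix.unitaryGroup (Fin (n + n)) ℂ := fun t => by
    rw [Matrix.mem_unitaryGroup_iff, hVs]
    simp only [V, add_mul, mul_sub, smul_mul_smul_comm, one_mul, mul_one, hAA]
    rw [mul_comm (Real.sin t : ℂ) (Real.cos t : ℂ)]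
    calc _ = ((Real.cos t : ℂ) * Real.cos t + (Real.sin t : ℂ) * Real.sin t) •
        (1 : Matrix (Fin (n + n)) (Fin (n + n)) ℂ) := by module
      _ = 1 := by rw [hcs, one_smul]
  have hcos : HasDerivAt (fun t : ℝ => (Real.cos t : ℂ)) 0 0 := by
    simpa using (Real.hasDerivAt_cos 0).ofReal_comp
  have hsin : HasDerivAt (fun t : ℝ => (Real.sin t : ℂ)) 1 0 := by
    simpa using (Real.hasDerivAt_sin 0).ofReal_comp
  have hcurve : HasDerivAt (fun t => star (V t) * Z * V t) (Z * A - A * Z) 0 := by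
    have hexp : (fun t => star (V t) * Z * V t) = fun t : ℝ =>
        ((Real.cos t : ℂ) * Real.cos t) • Z + ((Real.cos t : ℂ) * Real.sin t) • (Z * A - A * Z) -
          ((Real.sin t : ℂ) * Real.sin t) • (A * Z * A) := by
      funext t
      rw [hVs]
      simp only [V, sub_mul, mul_add, smul_mul_assoc, mul_smul_comm, one_mul, mul_one, mul_assoc]
      module
    rw [hexp]
    have := (((hcos.mul hcos).smul_const Z).add ((hcos.mul hsin).smul_const (Z * A - A * Z))).sub
      ((hsin.mul hsin).smul_const (A * Z * A))
    refine this.congr_deriv ?_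
    simp
  have h0 : star (V 0) * Z * V 0 = Z := by simp [V]
  have hL : HasDerivAt (fun t => u (n + n) (star (V t) * Z * V t) (Fin.castAdd n i)
      (Fin.natAdd n j))
      (fderiv ℝ (fun Y => u (n + n) Y (Fin.castAdd n i) (Fin.natAdd n j)) Z (Z * A - A * Z)) 0 := by
    have hd := ((hu.contDiffOn (n + n) (Fin.castAdd n i) (Fin.natAdd n j)).contDiffAt
      ((isOpen_annulus _).mem_nhds hZA)).differentiableAt (by norm_num)
    have hd' := hd.hasFDerivAt
    -- The base point is rewritten as the value of the curve at `t = 0`, the form the chain rule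
    -- expects.
    nth_rewrite 2 [← h0] at hd'
    exact hd'.comp_hasDerivAt (0 : ℝ) hcurve
  have hVent : ∀ k l, HasDerivAt (fun t => V t k l) (A k l) 0 := fun k l => by
    have := (hcos.mul_const ((1 : Matrix (Fin (n + n)) (Fin (n + n)) ℂ) k l)).add
      (hsin.mul_const (A k l))
    simpa [V, Pi.add_def] using this
  have hVsent : ∀ k l, HasDerivAt (fun t => star (V t k l)) (star (A k l)) 0 := fun k l =>
    (hVent k l).star
  have hV0 : V 0 = 1 := by simp [V]
  have hR : HasDerivAt (fun t => conjBy (V t) (u (n + n) Z) (Fin.castAdd n i) (Fin.natAdd n j))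
      (∑ k, ∑ l, (star (A k (Fin.castAdd n i)) * (1 : Matrix _ _ ℂ) l (Fin.natAdd n j) +
        star ((1 : Matrix _ _ ℂ) k (Fin.castAdd n i)) * A l (Fin.natAdd n j)) •
          u (n + n) Z k l) 0 := by
    simp only [conjBy, Matrix.of_apply]
    refine HasDerivAt.fun_sum fun k _ => HasDerivAt.fun_sum fun l _ => ?_
    have := ((hVsent k (Fin.castAdd n i)).mul (hVent l (Fin.natAdd n j))).smul_const
      (u (n + n) Z k l)
    rw [hV0] at this
    exact this
  have heq : ∀ t, u (n + n) (star (V t) * Z * V t) = conjBy (V t) (u (n + n) Z) := fun t =>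
    hu.isRealFree.map_unitary _ Z hZA _ (hVu t)
  simp only [heq] at hL
  rw [← hZAZ, hL.unique hR, hZ, hu.isRealFree.map_directSum n n X hX 1 (one_mem_annulus n),
    directSum_eq_blk, hA]
  simp [-Fin.natAdd_eq_addNat, Fin.sum_univ_add, Matrix.one_apply, add_smul,
    Finset.sum_add_distrib, sub_eq_add_neg, add_comm, apply_ite (starRingEnd ℂ)]

end Lift

section Lift

variable {R : Type*} [NormedAddCommGroup R] [NormedSpace ℂ R]

/-- With `L` the real derivative of the upper corner and `Δ = u(X) - u(1)`, the rotations give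
`L(P+Q) = Δ` and `L(iP-iQ) = iΔ`. Adding the linear part of `L` at `P` to its antilinear part at `Q`
yields `(Δ - i·iΔ)/2 = Δ`. By self-adjointness of `u`, that antilinear part is the adjoint of the
linear part for the lower corner. -/
lemma holoDeriv_add_star [StarAddMonoid R] [StarModule ℂ R]
    [ContinuousStar R] {u : GradedFun R} (hu : IsPluriharmonicFreeOn annulus u) {n : ℕ}
    {X : Matrix (Fin n) (Fin n) ℂ} (hX : X ∈ annulus n) (i j : Fin n) :
    holoDeriv (fun Y => u (n + n) Y (Fin.castAdd n i) (Fin.natAdd n j)) (directSum X 1)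
      (blk 0 (X - 1) 0 0) +
    star (holoDeriv (fun Y => u (n + n) Y (Fin.natAdd n j) (Fin.castAdd n i)) (directSum X 1)
      (blk 0 0 (X - 1) 0)) = u n X i j - u n 1 i j := by
  set Z := directSum X (1 : Matrix (Fin n) (Fin n) ℂ) with hZ
  have hZA : Z ∈ annulus (n + n) := directSum_mem_annulus hX (one_mem_annulus n)
  set L := fderiv ℝ (fun Y => u (n + n) Y (Fin.castAdd n i) (Fin.natAdd n j)) Z with hL
  set P : Matrix (Fin (n + n)) (Fin (n + n)) ℂ := blk 0 (X - 1) 0 0 with hP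
  set Q : Matrix (Fin (n + n)) (Fin (n + n)) ℂ := blk 0 0 (X - 1) 0 with hQ
  have hstar : ∀ H, star (fderiv ℝ
      (fun Y => u (n + n) Y (Fin.natAdd n j) (Fin.castAdd n i)) Z H) = L H := by
    intro H
    have hev : (fun Y => u (n + n) Y (Fin.castAdd n i) (Fin.natAdd n j)) =ᶠ[nhds Z]
        (starL' ℝ : R ≃L[ℝ] R) ∘ fun Y => u (n + n) Y (Fin.natAdd n j) (Fin.castAdd n i) := by
      filter_upwards [(isOpen_annulus _).mem_nhds hZA] with Y hY
      have := congr_fun₂ (hu.isSelfAdjoint _ Y hY) (Fin.castAdd n i) (Fin.natAdd n j)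
      rw [Matrix.star_apply] at this
      exact this.symm
    rw [hL, hev.fderiv_eq, ContinuousLinearEquiv.comp_fderiv]
    rfl
  have h1 : L (P + Q) = u n X i j - u n 1 i j := by
    have := fderiv_rotation hu hX (w := 1) (by simp) i j
    simpa [hL, hZ, hP, hQ, blk_add] using this
  have h2 : L (Complex.I • P - Complex.I • Q) = Complex.I • (u n X i j - u n 1 i j) := by
    have := fderiv_rotation hu hX (w := Complex.I) (by simp) i j
    rw [← this, hP, hQ, blk_smul, blk_smul, sub_eq_add_neg, ← neg_one_smul ℂ (blk _ _ _ _),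
      blk_smul, blk_add]
    simp [hL, hZ]
  rw [map_add] at h1
  rw [map_sub] at h2
  have h3 : star (holoDeriv (fun Y => u (n + n) Y (Fin.natAdd n j) (Fin.castAdd n i)) Z Q) =
      (1 / 2 : ℂ) • (L Q + Complex.I • L (Complex.I • Q)) := by
    rw [holoDeriv, star_smul, star_sub, star_smul, hstar, hstar]
    simp
  rw [h3, holoDeriv, ← hL]
  calc _ = (1 / 2 : ℂ) • ((L P + L Q) - Complex.I • (L (Complex.I • P) - L (Complex.I • Q))) := by
        module
    _ = _ := by
      rw [h1, h2, smul_smul, Complex.I_mul_I]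
      module

lemma holoLift_add_star [StarAddMonoid R] [StarModule ℂ R]
    [ContinuousStar R] {u : GradedFun R} (hu : IsPluriharmonicFreeOn annulus u) {n : ℕ}
    {X : Matrix (Fin n) (Fin n) ℂ} (hX : X ∈ annulus n) (i j : Fin n) :
    holoLift u n X i j + star (holoLift u n X j i) = u n X i j + u n X i j := by
  have h1 := holoDeriv_add_star hu hX i j
  have h2 := congr_arg star (holoDeriv_add_star hu hX j i)
  have h3 : ∀ Y ∈ annulus n, star (u n Y j i) = u n Y i j := fun Y hY =>
    congr_fun₂ (hu.isSelfAdjoint n Y hY) i j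
  rw [star_add, star_star, star_sub, h3 X hX, h3 1 (one_mem_annulus n)] at h2
  simp only [holoLift, star_add, h3 1 (one_mem_annulus n)]
  rw [← add_sub_cancel (u n 1 i j) (u n X i j)]
  nth_rewrite 1 [← h1]
  rw [← h2]
  abel

variable {E : Type*} [NormedAddCommGroup E] [NormedSpace ℂ E]

lemma holoDeriv_add (v : E → R) (X H K : E) :
    holoDeriv v X (H + K) = holoDeriv v X H + holoDeriv v X K := by
  simp only [holoDeriv, smul_add, map_add, smul_sub]
  abel

lemma holoDeriv_smul (v : E → R) (X H : E) (c : ℂ) :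
    holoDeriv v X (c • H) = c • holoDeriv v X H := by
  have h : ∀ K : E, fderiv ℝ v X (c • K) = (c.re : ℂ) • fderiv ℝ v X K +
      (c.im : ℂ) • fderiv ℝ v X (Complex.I • K) := fun K => by
    have hc : c • K = c.re • K + c.im • (Complex.I • K) := by
      conv_lhs => rw [← Complex.re_add_im c]
      rw [add_smul, mul_smul]
      rfl
    rw [hc, map_add, map_smul, map_smul]
    rfl
  rw [holoDeriv, smul_comm Complex.I c, h, h, smul_smul Complex.I Complex.I, Complex.I_mul_I,
    neg_one_smul, map_neg, holoDeriv]
  conv_rhs => rw [← Complex.re_add_im c]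
  have : (c.im : ℂ) • fderiv ℝ v X (Complex.I • H) =
      -((c.im : ℂ) * (Complex.I * Complex.I)) • fderiv ℝ v X (Complex.I • H) := by
    rw [Complex.I_mul_I]
    simp
  rw [this]
  module

/-- Here base point and direction both vary with `Y`. Expanding the direction in matrix units leaves
scalar entries times `holoDeriv` in fixed directions. -/
lemma differentiableAt_holoDeriv_linear {v : E → R} {s : Set E} {n : ℕ} (hs : IsOpen s)
    (hv : ContDiffOn ℝ 2 v s)
    (hlap : ∀ X ∈ s, ∀ H : E, Laplacian.laplacian (fun z : ℂ => v (X + z • H)) 0 = 0)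
    (D : Matrix (Fin n) (Fin n) ℂ → E) (T : Matrix (Fin n) (Fin n) ℂ →ₗ[ℂ] E)
    {X : Matrix (Fin n) (Fin n) ℂ} (hX : D X ∈ s) (hD : DifferentiableAt ℂ D X) :
    DifferentiableAt ℂ (fun Y => holoDeriv v (D Y) (T (Y - 1))) X := by
  let Λ : E → E →ₗ[ℂ] R := fun Z =>
    { toFun := holoDeriv v Z
      map_add' := holoDeriv_add v Z
      map_smul' := fun c H => holoDeriv_smul v Z H c }
  have hexp : ∀ Y, holoDeriv v (D Y) (T (Y - 1)) =
      ∑ k, ∑ l, (Y k l - (1 : Matrix (Fin n) (Fin n) ℂ) k l) •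
        holoDeriv v (D Y) (T (Matrix.single k l 1)) := by
    intro Y
    change Λ (D Y) (T (Y - 1)) = ∑ k, ∑ l, _ • Λ (D Y) (T (Matrix.single k l 1))
    conv_lhs => rw [Matrix.matrix_eq_sum_single (Y - 1)]
    simp only [map_sum]
    refine Finset.sum_congr rfl fun k _ => Finset.sum_congr rfl fun l _ => ?_
    rw [← map_smul, ← map_smul, Matrix.smul_single, smul_eq_mul, mul_one, Matrix.sub_apply]
  simp only [hexp]
  refine DifferentiableAt.fun_sum fun k _ => DifferentiableAt.fun_sum fun l _ => ?_
  have hent : DifferentiableAt ℂ (fun Y : Matrix (Fin n) (Fin n) ℂ => Y k l) X :=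
    (LinearMap.toContinuousLinearMap (Matrix.entryLinearMap ℂ ℂ k l)).differentiableAt
  exact (hent.sub_const _).smul
    ((differentiableAt_holoDeriv hs hv hlap hX (T (Matrix.single k l 1))).comp X hD)

lemma laplacian_eq_zero [StarAddMonoid R] {u : GradedFun R}
    (hu : IsPluriharmonicFreeOn annulus u) {n : ℕ} (i j : Fin n) :
    ∀ X ∈ annulus n, ∀ H : Matrix (Fin n) (Fin n) ℂ,
      Laplacian.laplacian (fun z : ℂ => u n (X + z • H) i j) 0 = 0 := by
  intro X hX H
  have := congr_fun₂ (hu.complexHessian_eq_zero n X hX H) i j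
  simp only [complexHessian, Matrix.of_apply, Matrix.zero_apply] at this
  exact (smul_eq_zero.1 this).resolve_left (by norm_num)

lemma differentiableAt_holoLift [StarAddMonoid R] {u : GradedFun R}
    (hu : IsPluriharmonicFreeOn annulus u) {n : ℕ} (i j : Fin n)
    {X : Matrix (Fin n) (Fin n) ℂ} (hX : X ∈ annulus n) :
    DifferentiableAt ℂ (fun Y => holoLift u n Y i j) X := by
  let T₁₁ : Matrix (Fin n) (Fin n) ℂ →ₗ[ℂ] Matrix (Fin (n + n)) (Fin (n + n)) ℂ :=
    { toFun := fun M => blk M 0 0 0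
      map_add' := fun M N => by simp [blk_add]
      map_smul' := fun c M => by simp [blk_smul] }
  let T₁₂ : Matrix (Fin n) (Fin n) ℂ →ₗ[ℂ] Matrix (Fin (n + n)) (Fin (n + n)) ℂ :=
    { toFun := fun M => blk 0 M 0 0
      map_add' := fun M N => by simp [blk_add]
      map_smul' := fun c M => by simp [blk_smul] }
  let T₂₁ : Matrix (Fin n) (Fin n) ℂ →ₗ[ℂ] Matrix (Fin (n + n)) (Fin (n + n)) ℂ :=
    { toFun := fun M => blk 0 0 M 0
      map_add' := fun M N => by simp [blk_add]
      map_smul' := fun c M => by simp [blk_smul] }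
  have hD : DifferentiableAt ℂ
      (fun Y : Matrix (Fin n) (Fin n) ℂ => directSum Y (1 : Matrix (Fin n) (Fin n) ℂ)) X := by
    have h : (fun Y : Matrix (Fin n) (Fin n) ℂ => directSum Y (1 : Matrix (Fin n) (Fin n) ℂ)) =
        fun Y => LinearMap.toContinuousLinearMap T₁₁ Y + blk 0 0 0 1 := by
      funext Y
      simp [T₁₁, directSum_eq_blk, blk_add]
    rw [h]
    exact (LinearMap.toContinuousLinearMap T₁₁).differentiableAt.add_const _
  have hZ := directSum_mem_annulus hX (one_mem_annulus n)
  exact ((differentiableAt_holoDeriv_linear (isOpen_annulus _) (hu.contDiffOn _ _ _)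
    (laplacian_eq_zero hu _ _) (fun Y => directSum Y 1) T₁₂ hZ hD).const_add _).add
    (differentiableAt_holoDeriv_linear (isOpen_annulus _) (hu.contDiffOn _ _ _)
    (laplacian_eq_zero hu _ _) (fun Y => directSum Y 1) T₂₁ hZ hD)

end Lift

/-! ### Unitary diagonalization and singular values -/

section MatrixLemmas

variable {n : ℕ}

/-- `W diag(d) V*`. -/
def diagConj (W V : Matrix (Fin n) (Fin n) ℂ) (d : Fin n → ℂ) : Matrix (Fin n) (Fin n) ℂ :=
  W * Matrix.diagonal d * star V

lemma diagConj_apply (W V : Matrix (Fin n) (Fin n) ℂ) (d : Fin n → ℂ) (i j : Fin n) :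
    diagConj W V d i j = ∑ l, W i l * star (V j l) * d l := by
  rw [diagConj, Matrix.mul_apply]
  refine Finset.sum_congr rfl fun l _ => ?_
  rw [Matrix.mul_diagonal, Matrix.star_apply]
  ring

lemma diagConj_mul {W V U : Matrix (Fin n) (Fin n) ℂ} (hV : V ∈ Matrix.unitaryGroup (Fin n) ℂ)
    (d e : Fin n → ℂ) : diagConj W V d * diagConj V U e = diagConj W U (d * e) := by
  have := Matrix.mem_unitaryGroup_iff'.1 hV
  calc _ = W * Matrix.diagonal d * (star V * V) * Matrix.diagonal e * star U := by
        simp only [diagConj, mul_assoc]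
    _ = _ := by
      rw [this, mul_one, mul_assoc W, Matrix.diagonal_mul_diagonal]
      rfl

lemma diagConj_one {V : Matrix (Fin n) (Fin n) ℂ} (hV : V ∈ Matrix.unitaryGroup (Fin n) ℂ) :
    diagConj V V 1 = 1 := by
  change V * Matrix.diagonal (fun _ => 1) * star V = 1
  rw [Matrix.diagonal_one, mul_one]
  exact Matrix.mem_unitaryGroup_iff.1 hV

lemma diagConj_pow {V : Matrix (Fin n) (Fin n) ℂ} (hV : V ∈ Matrix.unitaryGroup (Fin n) ℂ)
    (d : Fin n → ℂ) (m : ℕ) : diagConj V V d ^ m = diagConj V V (d ^ m) := by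
  induction m with
  | zero => rw [pow_zero, pow_zero, diagConj_one hV]
  | succ m ih => rw [pow_succ, ih, diagConj_mul hV, pow_succ]

lemma diagConj_inv {W V : Matrix (Fin n) (Fin n) ℂ} (hW : W ∈ Matrix.unitaryGroup (Fin n) ℂ)
    (hV : V ∈ Matrix.unitaryGroup (Fin n) ℂ) {d : Fin n → ℂ} (hd : ∀ i, d i ≠ 0) :
    (diagConj W V d)⁻¹ = diagConj V W d⁻¹ := by
  refine Matrix.inv_eq_right_inv ?_
  rw [diagConj_mul hV, ← diagConj_one hW]
  congr 1
  funext i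
  simp [hd i]

lemma norm_diagConj {W V : Matrix (Fin n) (Fin n) ℂ} (hW : W ∈ Matrix.unitaryGroup (Fin n) ℂ)
    (hV : V ∈ Matrix.unitaryGroup (Fin n) ℂ) (d : Fin n → ℂ) : ‖diagConj W V d‖ = ‖d‖ := by
  rw [diagConj, CStarRing.norm_mul_mem_unitary _ (Unitary.star_mem hV),
    CStarRing.norm_mem_unitary_mul _ hW, Matrix.l2_opNorm_diagonal]

lemma diagConj_mem_annulus {W V : Matrix (Fin n) (Fin n) ℂ}
    (hW : W ∈ Matrix.unitaryGroup (Fin n) ℂ) (hV : V ∈ Matrix.unitaryGroup (Fin n) ℂ)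
    {d : Fin n → ℂ} (h1 : ∀ i, 1 / 2 < ‖d i‖) (h2 : ∀ i, ‖d i‖ < 2) :
    diagConj W V d ∈ annulus n := by
  have hd : ∀ i, d i ≠ 0 := fun i h => by
    have := h1 i
    rw [h, norm_zero] at this
    linarith
  refine mem_annulus_of_mul_eq_one (Y := diagConj V W d⁻¹) ?_ ?_ ?_
  · rw [← diagConj_inv hW hV hd]
    refine Matrix.mul_nonsing_inv _ ?_
    refine Matrix.isUnit_det_of_right_inverse (B := diagConj V W d⁻¹) ?_
    rw [diagConj_mul hV, ← diagConj_one hW]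
    congr 1
    funext i
    simp [hd i]
  · rw [norm_diagConj hW hV, pi_norm_lt_iff (by norm_num)]
    exact h2
  · rw [norm_diagConj hV hW, pi_norm_lt_iff (by norm_num)]
    intro i
    rw [Pi.inv_apply, norm_inv, inv_lt_comm₀ (by linarith [h1 i]) (by norm_num)]
    linarith [h1 i]

lemma hermitian_eq_diagConj {K : Matrix (Fin n) (Fin n) ℂ} (hK : K.IsHermitian) :
    ∃ V ∈ Matrix.unitaryGroup (Fin n) ℂ,
      K = diagConj V V (fun i => (hK.eigenvalues i : ℂ)) :=
  ⟨hK.eigenvectorUnitary, hK.eigenvectorUnitary.2, by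
    conv_lhs => rw [hK.spectral_theorem, Unitary.conjStarAlgAut_apply]
    rfl⟩

/-- Write `N = exp(iK)` with `K = arg(N)` from the functional calculus, and diagonalize the
Hermitian `K`. The jump of `arg` is harmless because the spectrum is finite. -/
lemma exists_unitary_eq_diagConj {N : Matrix (Fin n) (Fin n) ℂ}
    (hN : N ∈ Matrix.unitaryGroup (Fin n) ℂ) :
    ∃ V ∈ Matrix.unitaryGroup (Fin n) ℂ, ∃ θ : Fin n → ℝ,
      N = diagConj V V (fun i => Complex.exp (Complex.I * θ i)) := by
  have hnorm : IsStarNormal N := ⟨by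
    rw [Commute, SemiconjBy, Matrix.mem_unitaryGroup_iff.1 hN, Matrix.mem_unitaryGroup_iff'.1 hN]⟩
  have hfin : ∀ f : ℂ → ℂ, ContinuousOn f (spectrum ℂ N) := fun f =>
    (Matrix.finite_spectrum N).continuousOn f
  set K := cfc (fun z : ℂ => (Complex.arg z : ℂ)) N with hK
  have hKs : IsSelfAdjoint K := by
    rw [isSelfAdjoint_iff, hK, ← cfc_star]
    exact cfc_congr fun z _ => by simp
  have hKn : IsStarNormal K := hKs.isStarNormal
  have hexp : NormedSpace.exp (Complex.I • K) = N := by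
    rw [← CFC.exp_eq_normedSpace_exp (𝕜 := ℂ), ← cfc_comp_smul .., hK,
      ← cfc_comp' (hg := by fun_prop) (hf := hfin _)]
    conv_rhs => rw [← cfc_id' ℂ N]
    refine cfc_congr fun y hy => ?_
    have hy₁ : ‖y‖ = 1 := spectrum.norm_eq_one_of_unitary hN hy
    have hlog : Complex.I * y.arg = Complex.log y :=
      Complex.ext (by simp [Complex.log_re, hy₁]) (by simp [Complex.log_im])
    have hy0 : y ≠ 0 := fun h => by simp [h] at hy₁
    simpa [← Complex.exp_eq_exp_ℂ, hlog] using Complex.exp_log hy0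
  have hherm : K.IsHermitian := hKs
  obtain ⟨V, hV, hVK⟩ := hermitian_eq_diagConj hherm
  refine ⟨V, hV, hherm.eigenvalues, ?_⟩
  have hVinv : V⁻¹ = star V := Matrix.inv_eq_right_inv (Matrix.mem_unitaryGroup_iff.1 hV)
  have hVu : IsUnit V := (Matrix.isUnit_iff_isUnit_det V).2
    (Matrix.isUnit_det_of_right_inverse (Matrix.mem_unitaryGroup_iff.1 hV))
  have hIK : Complex.I • K =
      V * Matrix.diagonal (fun i => Complex.I * (hherm.eigenvalues i : ℂ)) * V⁻¹ := by
    conv_lhs => rw [hVK]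
    rw [diagConj, hVinv, ← Matrix.smul_mul, ← Matrix.mul_smul]
    congr 2
    ext i j
    simp [Matrix.diagonal_apply]
  conv_lhs => rw [← hexp, hIK]
  rw [Matrix.exp_conj _ _ hVu, Matrix.exp_diagonal, hVinv, diagConj]
  congr 3
  funext i
  rw [Pi.coe_exp, Complex.exp_eq_exp_ℂ]

-- Singular values come from diagonalizing `X*X`. Writing them as `exp(b i)` allows scaling by a
-- complex parameter, and the bounds on `‖X‖` and `‖X⁻¹‖` become the single bound on `|b i|`.
open scoped ComplexOrder in
lemma exists_svd {X : Matrix (Fin n) (Fin n) ℂ} (hX : X ∈ annulus n) :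
    ∃ W ∈ Matrix.unitaryGroup (Fin n) ℂ, ∃ V ∈ Matrix.unitaryGroup (Fin n) ℂ,
      ∃ b : Fin n → ℝ, (∀ i, |b i| < Real.log 2) ∧
        X = diagConj W V (fun i => Complex.exp (b i)) := by
  have hpd : (X.conjTranspose * X).PosDef := Matrix.PosDef.conjTranspose_mul_self X
    (Matrix.mulVec_injective_iff_isUnit.2 hX.1)
  obtain ⟨V, hV, hVK⟩ := hermitian_eq_diagConj hpd.isHermitian
  set d := hpd.isHermitian.eigenvalues with hd
  have hdpos : ∀ i, 0 < d i := hpd.eigenvalues_pos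
  -- The eigenvalues of `X*X` are the squares of the singular values, hence the factor one half.
  let b : Fin n → ℝ := fun i => Real.log (d i) / 2
  have hbd : ∀ i, (d i : ℂ) = Complex.exp (b i) * Complex.exp (b i) := fun i => by
    rw [← Complex.exp_add, ← Complex.ofReal_add, ← Complex.ofReal_exp]
    simp only [b, add_halves, Real.exp_log (hdpos i)]
  have hne : ∀ i, Complex.exp (b i : ℂ) ≠ 0 := fun i => Complex.exp_ne_zero _
  let e : Fin n → ℂ := fun i => Complex.exp (b i)
  let W : Matrix (Fin n) (Fin n) ℂ := X * diagConj V 1 e⁻¹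
  have h1 : (1 : Matrix (Fin n) (Fin n) ℂ) ∈ Matrix.unitaryGroup (Fin n) ℂ := one_mem _
  have hstar : star (diagConj V 1 e⁻¹) = diagConj 1 V e⁻¹ := by
    ext i j
    rw [Matrix.star_apply, diagConj_apply, diagConj_apply, star_sum]
    refine Finset.sum_congr rfl fun l _ => ?_
    have he : star (e⁻¹ l) = e⁻¹ l := by simp [e, ← Complex.exp_conj]
    rw [star_mul', star_mul', star_star, he]
    ring
  have hW : W ∈ Matrix.unitaryGroup (Fin n) ℂ := by
    rw [Matrix.mem_unitaryGroup_iff']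
    calc star W * W = diagConj 1 V e⁻¹ * (X.conjTranspose * X) * diagConj V 1 e⁻¹ := by
          simp only [W, star_mul, hstar, mul_assoc]
          rfl
      _ = 1 := by
        rw [hVK, diagConj_mul hV, diagConj_mul hV]
        refine Eq.trans ?_ (diagConj_one h1)
        congr 1
        funext i
        simp only [Pi.mul_apply, Pi.inv_apply, Pi.one_apply, hbd, e]
        field_simp [hne i]
  have hXW : X = diagConj W V e := by
    have : diagConj W V e = X * (diagConj V 1 e⁻¹ * diagConj 1 V e) := by
      simp only [W, diagConj, mul_assoc, star_one, one_mul]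
    rw [this, diagConj_mul h1]
    have he : e⁻¹ * e = 1 := by
      funext i
      simp [e]
    rw [he, diagConj_one hV, mul_one]
  refine ⟨W, hW, V, hV, b, fun i => ?_, hXW⟩
  have hn := hX.2.1
  have hn' := hX.2.2
  rw [hXW, norm_diagConj hW hV, pi_norm_lt_iff (by norm_num)] at hn
  rw [hXW, diagConj_inv hW hV hne, norm_diagConj hV hW, pi_norm_lt_iff (by norm_num)] at hn'
  have hni := hn i
  have hni' := hn' i
  simp only [e, Pi.inv_apply, ← Complex.exp_neg, Complex.norm_exp, Complex.neg_re,
    Complex.ofReal_re] at hni hni'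
  rw [abs_lt, neg_lt]
  exact ⟨(Real.lt_log_iff_exp_lt (by norm_num)).2 hni', (Real.lt_log_iff_exp_lt (by norm_num)).2 hni⟩

end MatrixLemmas

/-! ### Free functions on diagonalizable matrices -/

section FreeFunction

variable {R : Type*} [AddCommGroup R] [Module ℂ R]

lemma diagonal_eq_diagConj {n : ℕ} (d : Fin n → ℂ) : Matrix.diagonal d = diagConj 1 1 d := by
  simp [diagConj]

lemma diagonal_mem_annulus {n : ℕ} {d : Fin n → ℂ} (h1 : ∀ i, 1 / 2 < ‖d i‖)
    (h2 : ∀ i, ‖d i‖ < 2) : Matrix.diagonal d ∈ annulus n := by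
  rw [diagonal_eq_diagConj]
  exact diagConj_mem_annulus (one_mem _) (one_mem _) h1 h2

lemma castAdd_ne_natAdd {m n : ℕ} (i : Fin m) (j : Fin n) : Fin.castAdd n i ≠ Fin.natAdd m j := by
  intro h
  have := congr_arg Fin.val h
  simp only [Fin.val_castAdd, Fin.val_natAdd] at this
  omega

/-- A diagonal matrix is an iterated direct sum of `1 × 1` blocks; the last one is split off at each
stage. -/
lemma map_diagonal {u : GradedFun R} (hu : IsRealFreeOn annulus u) {n : ℕ} (d : Fin n → ℂ)
    (h1 : ∀ i, 1 / 2 < ‖d i‖) (h2 : ∀ i, ‖d i‖ < 2) :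
    u n (Matrix.diagonal d) =
      Matrix.diagonal fun i => u 1 (Matrix.diagonal fun _ => d i) 0 0 := by
  induction n with
  | zero => exact Subsingleton.elim _ _
  | succ n ih =>
    have hsplit : Matrix.diagonal d = directSum (Matrix.diagonal fun i => d (Fin.castAdd 1 i))
        (Matrix.diagonal fun i => d (Fin.natAdd n i)) := by
      rw [directSum_eq_blk]
      refine blk_ext ?_ ?_ ?_ ?_ <;> intros <;>
        simp [Matrix.diagonal_apply, -Fin.natAdd_eq_addNat, castAdd_ne_natAdd,
          (castAdd_ne_natAdd _ _).symm]
    rw [hsplit, hu.map_directSum n 1 _ (diagonal_mem_annulus (fun i => h1 _) fun i => h2 _) _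
      (diagonal_mem_annulus (fun i => h1 _) fun i => h2 _), ih _ (fun i => h1 _) fun i => h2 _,
      directSum_eq_blk]
    refine blk_ext ?_ ?_ ?_ ?_ <;> intros <;>
      simp [Matrix.diagonal_apply, -Fin.natAdd_eq_addNat, castAdd_ne_natAdd, (castAdd_ne_natAdd _ _).symm,
        Subsingleton.elim _ (0 : Fin 1)]

lemma map_diagConj {u : GradedFun R} (hu : IsRealFreeOn annulus u) {n : ℕ}
    {V : Matrix (Fin n) (Fin n) ℂ} (hV : V ∈ Matrix.unitaryGroup (Fin n) ℂ) (d : Fin n → ℂ)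
    (h1 : ∀ i, 1 / 2 < ‖d i‖) (h2 : ∀ i, ‖d i‖ < 2) (i j : Fin n) :
    u n (diagConj V V d) i j =
      ∑ l, (V i l * star (V j l)) • u 1 (Matrix.diagonal fun _ => d l) 0 0 := by
  -- The invariance is stated for `V* X V` whereas `diagConj` has the form `V D V*`, so it is
  -- applied to `star V`.
  have h := hu.map_unitary n _ (diagonal_mem_annulus h1 h2) (star V) (Unitary.star_mem hV)
  rw [star_star] at h
  rw [diagConj, h, map_diagonal hu d h1 h2]
  simp only [conjBy, Matrix.of_apply, Matrix.star_apply, star_star]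
  refine Finset.sum_congr rfl fun k _ => ?_
  rw [Finset.sum_eq_single k]
  · rw [Matrix.diagonal_apply_eq]
  · intro l _ hl
    rw [Matrix.diagonal_apply_ne' _ hl, smul_zero]
  · simp

end FreeFunction

/-! ### Exponential curves inside the annulus -/

section Strip

variable {n : ℕ}

/-- The strip `|Re z| |b i| < ρ` for all `i`. -/
def strip (b : Fin n → ℝ) (ρ : ℝ) : Set ℂ := {z | ∀ i, |z.re * b i| < ρ}

lemma isOpen_strip (b : Fin n → ℝ) (ρ : ℝ) : IsOpen (strip b ρ) := by
  simp only [strip, Set.ofPred_forall]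
  exact isOpen_iInter_of_finite fun i =>
    isOpen_lt (Complex.continuous_re.mul continuous_const).abs continuous_const

lemma isPreconnected_strip (b : Fin n → ℝ) (ρ : ℝ) : IsPreconnected (strip b ρ) := by
  refine Convex.isPreconnected ?_
  intro x hx y hy s t hs ht hst i
  have h : (s • x + t • y).re * b i = s * (x.re * b i) + t * (y.re * b i) := by
    simp only [Complex.add_re, Complex.real_smul, Complex.re_ofReal_mul]
    ring
  rw [h]
  have hball : ∀ y : ℝ, |y| < ρ ↔ y ∈ Metric.ball (0 : ℝ) ρ := fun y => by
    rw [mem_ball_zero_iff, Real.norm_eq_abs]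
  rw [hball]
  exact convex_ball (0 : ℝ) ρ ((hball _).1 (hx i)) ((hball _).1 (hy i)) hs ht hst

/-- The holomorphic curve `z ↦ W exp(z diag(b)) V*`. -/
noncomputable def expCurve (W V : Matrix (Fin n) (Fin n) ℂ) (b : Fin n → ℝ) (z : ℂ) :
    Matrix (Fin n) (Fin n) ℂ := diagConj W V fun i => Complex.exp (z * b i)

lemma norm_exp_bounds {b : Fin n → ℝ} {ρ : ℝ} {z : ℂ} (hz : z ∈ strip b ρ)
    (i : Fin n) : Real.exp (-ρ) < ‖Complex.exp (z * b i)‖ ∧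
      ‖Complex.exp (z * b i)‖ < Real.exp ρ := by
  have := abs_lt.1 (hz i)
  rw [Complex.norm_exp, Complex.re_mul_ofReal]
  exact ⟨Real.exp_lt_exp.2 this.1, Real.exp_lt_exp.2 this.2⟩

lemma half_lt_exp_neg {ρ : ℝ} (hρ : ρ < Real.log 2) : 1 / 2 < Real.exp (-ρ) := by
  rw [one_div, Real.exp_neg]
  exact inv_strictAnti₀ (Real.exp_pos _) ((Real.lt_log_iff_exp_lt (by norm_num)).1 hρ)

lemma norm_exp_mem {b : Fin n → ℝ} {ρ : ℝ} (hρ : ρ < Real.log 2) {z : ℂ} (hz : z ∈ strip b ρ)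
    (i : Fin n) : 1 / 2 < ‖Complex.exp (z * b i)‖ ∧ ‖Complex.exp (z * b i)‖ < 2 := by
  obtain ⟨h1, h2⟩ := norm_exp_bounds hz i
  exact ⟨(half_lt_exp_neg hρ).trans h1, h2.trans ((Real.lt_log_iff_exp_lt (by norm_num)).1 hρ)⟩

lemma expCurve_mem {W V : Matrix (Fin n) (Fin n) ℂ} (hW : W ∈ Matrix.unitaryGroup (Fin n) ℂ)
    (hV : V ∈ Matrix.unitaryGroup (Fin n) ℂ) {b : Fin n → ℝ} {ρ : ℝ} (hρ : ρ < Real.log 2)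
    {z : ℂ} (hz : z ∈ strip b ρ) : expCurve W V b z ∈ annulus n :=
  diagConj_mem_annulus hW hV (fun i => (norm_exp_mem hρ hz i).1) fun i => (norm_exp_mem hρ hz i).2

lemma differentiable_expCurve (W V : Matrix (Fin n) (Fin n) ℂ) (b : Fin n → ℝ) :
    Differentiable ℂ (expCurve W V b) := by
  have h1 : Differentiable ℂ fun z : ℂ => fun i => Complex.exp (z * b i) := by fun_prop
  have h2 : Differentiable ℂ fun z : ℂ =>
      Matrix.diagonal fun i => Complex.exp (z * b i) :=
    (LinearMap.toContinuousLinearMap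
      (Matrix.diagonalLinearMap (Fin n) ℂ ℂ)).differentiable.comp h1
  exact (h2.const_mul W).mul_const (star V)

lemma expCurve_inv {W V : Matrix (Fin n) (Fin n) ℂ} (hW : W ∈ Matrix.unitaryGroup (Fin n) ℂ)
    (hV : V ∈ Matrix.unitaryGroup (Fin n) ℂ) (b : Fin n → ℝ) (z : ℂ) :
    (expCurve W V b z)⁻¹ = expCurve V W b (-z) := by
  rw [expCurve, diagConj_inv hW hV fun i => Complex.exp_ne_zero _, expCurve]
  congr 1
  funext i
  rw [Pi.inv_apply, ← Complex.exp_neg, neg_mul]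

lemma differentiable_expCurve_zpow {W V : Matrix (Fin n) (Fin n) ℂ}
    (hW : W ∈ Matrix.unitaryGroup (Fin n) ℂ) (hV : V ∈ Matrix.unitaryGroup (Fin n) ℂ)
    (b : Fin n → ℝ) (k : ℤ) : Differentiable ℂ fun z => expCurve W V b z ^ k := by
  rcases le_total 0 k with hk | hk
  · obtain ⟨m, rfl⟩ := Int.eq_ofNat_of_zero_le hk
    simp only [zpow_natCast]
    exact (differentiable_expCurve W V b).pow m
  · obtain ⟨m, rfl⟩ := Int.exists_eq_neg_ofNat hk
    simp only [Matrix.zpow_neg_natCast, ← Matrix.inv_pow', expCurve_inv hW hV]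
    exact ((differentiable_expCurve V W b).comp differentiable_neg).pow m

end Strip

/-! ### The Laurent series with a matrix argument -/

section Laurent

variable {n : ℕ} {R : Type*} [NormedAddCommGroup R] [NormedSpace ℂ R]

lemma norm_pow_le_of_norm_le {X : Matrix (Fin n) (Fin n) ℂ} {ρ : ℝ} (hX : ‖X‖ ≤ ρ) (m : ℕ) :
    ‖X ^ m‖ ≤ ρ ^ m := by
  induction m with
  | zero =>
    rw [pow_zero, pow_zero, ← Matrix.diagonal_one, Matrix.l2_opNorm_diagonal,
      pi_norm_le_iff_of_nonneg zero_le_one]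
    simp
  | succ m ih =>
    rw [pow_succ, pow_succ]
    exact (norm_mul_le _ _).trans (mul_le_mul ih hX (norm_nonneg _)
      ((norm_nonneg _).trans ih))

lemma norm_zpow_le {X : Matrix (Fin n) (Fin n) ℂ} {ρ : ℝ} (hX : ‖X‖ ≤ ρ) (hX' : ‖X⁻¹‖ ≤ ρ)
    (k : ℤ) : ‖X ^ k‖ ≤ ρ ^ k.natAbs := by
  rcases le_total 0 k with hk | hk
  · obtain ⟨m, rfl⟩ := Int.eq_ofNat_of_zero_le hk
    simpa using norm_pow_le_of_norm_le hX m
  · obtain ⟨m, rfl⟩ := Int.exists_eq_neg_ofNat hk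
    rw [Matrix.zpow_neg_natCast, ← Matrix.inv_pow']
    simpa using norm_pow_le_of_norm_le hX' m

lemma exists_norm_entry_le (i j : Fin n) :
    ∃ C, 0 ≤ C ∧ ∀ X : Matrix (Fin n) (Fin n) ℂ, ‖X i j‖ ≤ C * ‖X‖ :=
  ⟨_, norm_nonneg _, fun X =>
    (LinearMap.toContinuousLinearMap (Matrix.entryLinearMap ℂ ℂ i j)).le_opNorm X⟩

/-- The entries of the Laurent series `∑ c_k X^k`. -/
noncomputable def laurentSum (c : ℤ → R) (X : Matrix (Fin n) (Fin n) ℂ) :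
    Matrix (Fin n) (Fin n) R := Matrix.of fun i j => ∑' k : ℤ, (X ^ k) i j • c k

variable {c : ℤ → R}

lemma hasSum_laurentSum [CompleteSpace R]
    (hc : ∀ ρ : ℝ, 0 ≤ ρ → ρ < 2 → Summable fun k => ‖c k‖ * ρ ^ k.natAbs)
    {X : Matrix (Fin n) (Fin n) ℂ} (hX : X ∈ annulus n) (i j : Fin n) :
    HasSum (fun k : ℤ => (X ^ k) i j • c k) (laurentSum c X i j) := by
  obtain ⟨C, hC, hCX⟩ := exists_norm_entry_le i j
  refine Summable.hasSum (Summable.of_norm_bounded ((hc (max ‖X‖ ‖X⁻¹‖) (by positivity)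
    (max_lt hX.2.1 hX.2.2)).mul_left C) fun k => ?_)
  rw [norm_smul]
  calc _ ≤ (C * (max ‖X‖ ‖X⁻¹‖) ^ k.natAbs) * ‖c k‖ := by
        gcongr
        refine (hCX _).trans ?_
        gcongr
        exact norm_zpow_le (le_max_left _ _) (le_max_right _ _) k
    _ = _ := by ring

lemma hasSum_coeffMul [CompleteSpace R]
    (hc : ∀ ρ : ℝ, 0 ≤ ρ → ρ < 2 → Summable fun k => ‖c k‖ * ρ ^ k.natAbs)
    {X : Matrix (Fin n) (Fin n) ℂ} (hX : X ∈ annulus n) :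
    HasSum (fun k : ℤ => coeffMul (c k) (X ^ k)) (laurentSum c X) :=
  Pi.hasSum.2 fun i => Pi.hasSum.2 fun j => hasSum_laurentSum hc hX i j

/-- On the strip both the curve and its inverse have norm at most `exp ρ < 2`, giving a summable
majorant independent of `z`. -/
lemma differentiableOn_laurentSum [CompleteSpace R]
    (hc : ∀ ρ : ℝ, 0 ≤ ρ → ρ < 2 → Summable fun k => ‖c k‖ * ρ ^ k.natAbs)
    {W V : Matrix (Fin n) (Fin n) ℂ}
    (hW : W ∈ Matrix.unitaryGroup (Fin n) ℂ) (hV : V ∈ Matrix.unitaryGroup (Fin n) ℂ)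
    {b : Fin n → ℝ} {ρ : ℝ} (hρ : ρ < Real.log 2) (i j : Fin n) :
    DifferentiableOn ℂ (fun z => laurentSum c (expCurve W V b z) i j) (strip b ρ) := by
  obtain ⟨C, hC, hCX⟩ := exists_norm_entry_le i j
  have h2 : Real.exp ρ < 2 := (Real.lt_log_iff_exp_lt (by norm_num)).1 hρ
  have hnorm : ∀ {W V : Matrix (Fin n) (Fin n) ℂ}, W ∈ Matrix.unitaryGroup (Fin n) ℂ →
      V ∈ Matrix.unitaryGroup (Fin n) ℂ → ∀ z ∈ strip b ρ, ‖expCurve W V b z‖ ≤ Real.exp ρ := by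
    intro W V hW hV z hz
    rw [expCurve, norm_diagConj hW hV, pi_norm_le_iff_of_nonneg (Real.exp_pos _).le]
    exact fun i => (norm_exp_bounds hz i).2.le
  refine Complex.differentiableOn_tsum_of_summable_norm
    ((hc (Real.exp ρ) (Real.exp_pos _).le h2).mul_left C) (fun k => ?_) (isOpen_strip b ρ)
    fun k z hz => ?_
  · have hent : Differentiable ℂ fun z => (expCurve W V b z ^ k) i j :=
      (LinearMap.toContinuousLinearMap
        (Matrix.entryLinearMap ℂ ℂ i j)).differentiable.comp (differentiable_expCurve_zpow hW hV b k)
    exact (hent.smul_const (c k)).differentiableOn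
  · rw [norm_smul]
    have hz' : -z ∈ strip b ρ := fun i => by simpa using hz i
    calc _ ≤ (C * Real.exp ρ ^ k.natAbs) * ‖c k‖ := by
          gcongr
          refine (hCX _).trans ?_
          gcongr
          refine norm_zpow_le (hnorm hW hV z hz) ?_ k
          rw [expCurve_inv hW hV]
          exact hnorm hV hW _ hz'
      _ = _ := by ring

lemma diagConj_zpow {V : Matrix (Fin n) (Fin n) ℂ} (hV : V ∈ Matrix.unitaryGroup (Fin n) ℂ)
    {d : Fin n → ℂ} (hd : ∀ i, d i ≠ 0) (k : ℤ) :
    diagConj V V d ^ k = diagConj V V (d ^ k) := by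
  rcases le_total 0 k with hk | hk
  · obtain ⟨m, rfl⟩ := Int.eq_ofNat_of_zero_le hk
    simp only [zpow_natCast, diagConj_pow hV]
  · obtain ⟨m, rfl⟩ := Int.exists_eq_neg_ofNat hk
    rw [Matrix.zpow_neg_natCast, ← Matrix.inv_pow', diagConj_inv hV hV hd, diagConj_pow hV,
      zpow_neg, zpow_natCast, inv_pow]

/-- Powers act on the eigenvalues alone, so the matrix series is a finite combination of scalar
ones. This matches the formula for `u` in `map_diagConj`. -/
lemma laurentSum_diagConj [CompleteSpace R]
    (hc : ∀ ρ : ℝ, 0 ≤ ρ → ρ < 2 → Summable fun k => ‖c k‖ * ρ ^ k.natAbs)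
    {φ : ℂ → R} (hφ : ∀ z : ℂ, 1 / 2 < ‖z‖ → ‖z‖ < 2 → HasSum (fun k : ℤ => z ^ k • c k) (φ z))
    {V : Matrix (Fin n) (Fin n) ℂ} (hV : V ∈ Matrix.unitaryGroup (Fin n) ℂ) {d : Fin n → ℂ}
    (h1 : ∀ i, 1 / 2 < ‖d i‖) (h2 : ∀ i, ‖d i‖ < 2) (i j : Fin n) :
    laurentSum c (diagConj V V d) i j = ∑ l, (V i l * star (V j l)) • φ (d l) := by
  have hd : ∀ i, d i ≠ 0 := fun i h => by
    have := h1 i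
    rw [h, norm_zero] at this
    linarith
  refine (hasSum_laurentSum hc (diagConj_mem_annulus hV hV h1 h2) i j).unique ?_
  have hs := hasSum_sum (s := Finset.univ)
    fun l _ => (hφ (d l) (h1 l) (h2 l)).const_smul (V i l * star (V j l))
  convert hs using 2 with k
  rw [diagConj_zpow hV hd, diagConj_apply, Finset.sum_smul]
  refine Finset.sum_congr rfl fun l _ => ?_
  rw [mul_smul, Pi.pow_apply]

end Laurent

/-! ### Rigidity of holomorphic functions -/

section Uniqueness

variable {R : Type*} [NormedAddCommGroup R] [NormedSpace ℂ R]

/-- Differentiating in the directions `1` and `i` gives `f' = -(g')*` and `i f' = i (g')*`, so `2i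
f' = 0`. A second function `g` is allowed because the adjoint of a matrix swaps the entries `(i,j)`
and `(j,i)`. -/
lemma deriv_eq_zero_of_add_star_eq_zero [StarAddMonoid R] [StarModule ℂ R] [ContinuousStar R]
    {f g : ℂ → R} {s : Set ℂ} (hs : IsOpen s) (hf : DifferentiableOn ℂ f s)
    (hg : DifferentiableOn ℂ g s) (h : ∀ z ∈ s, f z + star (g z) = 0) {z : ℂ} (hz : z ∈ s) :
    deriv f z = 0 := by
  have hsz := hs.mem_nhds hz
  have hf' := ((hf.differentiableAt hsz).hasDerivAt.hasFDerivAt).restrictScalars ℝ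
  have hg' := ((hg.differentiableAt hsz).hasDerivAt.hasFDerivAt).restrictScalars ℝ
  have hsg := (starL' ℝ : R ≃L[ℝ] R).hasFDerivAt.comp z hg'
  have hsum := hf'.add hsg
  have hev : (f + (starL' ℝ : R ≃L[ℝ] R) ∘ g) =ᶠ[nhds z] fun _ => 0 := by
    filter_upwards [hsz] with y hy using h y hy
  have h0 := hsum.unique ((hasFDerivAt_const (0 : R) z).congr_of_eventuallyEq hev)
  have h1 : deriv f z + star (deriv g z) = 0 := by
    simpa using DFunLike.congr_fun h0 (1 : ℂ)
  have h2 : Complex.I • deriv f z + star (Complex.I • deriv g z) = 0 := by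
    simpa using DFunLike.congr_fun h0 Complex.I
  rw [star_smul, eq_neg_of_add_eq_zero_right h1] at h2
  simp only [Complex.star_def, Complex.conj_I, smul_neg, neg_smul, neg_neg, ← two_smul ℂ] at h2
  rw [smul_smul] at h2
  exact (smul_eq_zero.1 h2).resolve_left (by simp)

/-- The strip is convex and zeros on the imaginary axis accumulate at `0`, so the identity theorem
applies. -/
lemma eqOn_strip_of_imaginary [CompleteSpace R] {n : ℕ} {b : Fin n → ℝ} {ρ : ℝ} (hρ : 0 < ρ)
    {f : ℂ → R} (hf : DifferentiableOn ℂ f (strip b ρ)) (h : ∀ t : ℝ, f (t * Complex.I) = 0)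
    {z : ℂ} (hz : z ∈ strip b ρ) : f z = 0 := by
  have h0 : (0 : ℂ) ∈ strip b ρ := fun i => by simpa using hρ
  refine (hf.analyticOnNhd (isOpen_strip b ρ)).eqOn_zero_of_preconnected_of_frequently_eq_zero
    (isPreconnected_strip b ρ) h0 ?_ hz
  have ht : Filter.Tendsto (fun t : ℝ => (t : ℂ) * Complex.I) (nhdsWithin 0 {0}ᶜ)
      (nhdsWithin 0 {0}ᶜ) := by
    refine tendsto_nhdsWithin_iff.2 ⟨?_, ?_⟩
    · have : Continuous fun t : ℝ => (t : ℂ) * Complex.I := by fun_prop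
      simpa using (this.tendsto 0).mono_left nhdsWithin_le_nhds
    · filter_upwards [self_mem_nhdsWithin] with t ht
      simpa using ht
  exact ht.frequently (Filter.Frequently.of_forall h)

end Uniqueness

/-! ### Comparison of the lift with its Laurent series -/

section Main

variable {R : Type*} [NormedAddCommGroup R] [NormedSpace ℂ R] [CompleteSpace R]
  [StarAddMonoid R]

lemma exists_laurent_coeff {u : GradedFun R} (hu : IsPluriharmonicFreeOn annulus u) :
    ∃ c : ℤ → R, (∀ ρ : ℝ, 0 ≤ ρ → ρ < 2 → Summable fun k => ‖c k‖ * ρ ^ k.natAbs) ∧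
      ∀ z : ℂ, 1 / 2 < ‖z‖ → ‖z‖ < 2 →
        HasSum (fun k => z ^ k • c k) (holoLift u 1 (Matrix.diagonal fun _ => z) 0 0) := by
  refine exists_laurent fun z hz => DifferentiableAt.differentiableWithinAt ?_
  have h1 : Differentiable ℂ fun z : ℂ => fun _ : Fin 1 => z := by fun_prop
  have h2 : Differentiable ℂ fun z : ℂ => (Matrix.diagonal fun _ : Fin 1 => z) :=
    (LinearMap.toContinuousLinearMap
      (Matrix.diagonalLinearMap (Fin 1) ℂ ℂ)).differentiable.comp h1
  exact (differentiableAt_holoLift hu 0 0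
    (diagonal_mem_annulus (fun _ => hz.1) fun _ => hz.2)).comp z (h2 z)

variable {u : GradedFun R} {c : ℤ → R} {n : ℕ}

/-- The difference between the holomorphic lift and the Laurent series. -/
noncomputable def liftDiff (u : GradedFun R) (c : ℤ → R) (X : Matrix (Fin n) (Fin n) ℂ)
    (i j : Fin n) : R := holoLift u n X i j - laurentSum c X i j

lemma differentiableOn_liftDiff (hu : IsPluriharmonicFreeOn annulus u)
    (hc : ∀ ρ : ℝ, 0 ≤ ρ → ρ < 2 → Summable fun k => ‖c k‖ * ρ ^ k.natAbs)
    {W V : Matrix (Fin n) (Fin n) ℂ}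
    (hW : W ∈ Matrix.unitaryGroup (Fin n) ℂ) (hV : V ∈ Matrix.unitaryGroup (Fin n) ℂ)
    {b : Fin n → ℝ} {ρ : ℝ} (hρ : ρ < Real.log 2) (i j : Fin n) :
    DifferentiableOn ℂ (fun z => liftDiff u c (expCurve W V b z) i j) (strip b ρ) :=
  DifferentiableOn.sub (fun z hz => ((differentiableAt_holoLift hu i j
    (expCurve_mem hW hV hρ hz)).comp z
      (differentiable_expCurve W V b z)).differentiableWithinAt)
    (differentiableOn_laurentSum hc hW hV hρ i j)

variable [StarModule ℂ R] [ContinuousStar R]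

/-- Diagonalization reduces the claim to eigenvalues, where it is the size-one case of
`holoLift_add_star`. -/
lemma laurentSum_add_star (hu : IsPluriharmonicFreeOn annulus u)
    (hc : ∀ ρ : ℝ, 0 ≤ ρ → ρ < 2 → Summable fun k => ‖c k‖ * ρ ^ k.natAbs)
    (hφ : ∀ z : ℂ, 1 / 2 < ‖z‖ → ‖z‖ < 2 →
      HasSum (fun k => z ^ k • c k) (holoLift u 1 (Matrix.diagonal fun _ => z) 0 0))
    {V : Matrix (Fin n) (Fin n) ℂ} (hV : V ∈ Matrix.unitaryGroup (Fin n) ℂ) {d : Fin n → ℂ}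
    (h1 : ∀ i, 1 / 2 < ‖d i‖) (h2 : ∀ i, ‖d i‖ < 2) (i j : Fin n) :
    laurentSum c (diagConj V V d) i j + star (laurentSum c (diagConj V V d) j i) =
      u n (diagConj V V d) i j + u n (diagConj V V d) i j := by
  rw [laurentSum_diagConj hc hφ hV h1 h2, laurentSum_diagConj hc hφ hV h1 h2,
    map_diagConj hu.isRealFree hV d h1 h2, star_sum, ← Finset.sum_add_distrib,
    ← Finset.sum_add_distrib]
  refine Finset.sum_congr rfl fun l _ => ?_
  rw [star_smul, star_mul', star_star, mul_comm (star (V j l)), ← smul_add, ← smul_add,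
    holoLift_add_star hu (diagonal_mem_annulus (fun _ => h1 l) fun _ => h2 l)]

lemma liftDiff_add_star
    (hu : IsPluriharmonicFreeOn annulus u)
    (hc : ∀ ρ : ℝ, 0 ≤ ρ → ρ < 2 → Summable fun k => ‖c k‖ * ρ ^ k.natAbs)
    (hφ : ∀ z : ℂ, 1 / 2 < ‖z‖ → ‖z‖ < 2 →
      HasSum (fun k => z ^ k • c k) (holoLift u 1 (Matrix.diagonal fun _ => z) 0 0))
    {V : Matrix (Fin n) (Fin n) ℂ} (hV : V ∈ Matrix.unitaryGroup (Fin n) ℂ)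
    {b : Fin n → ℝ} {ρ : ℝ} (hρ : ρ < Real.log 2) {z : ℂ} (hz : z ∈ strip b ρ) (i j : Fin n) :
    liftDiff u c (expCurve V V b z) i j + star (liftDiff u c (expCurve V V b z) j i) = 0 := by
  have h1 := holoLift_add_star hu (expCurve_mem hV hV hρ hz) i j
  have h2 := laurentSum_add_star hu hc hφ hV (fun i => (norm_exp_mem hρ hz i).1)
    (fun i => (norm_exp_mem hρ hz i).2) i j
  rw [← expCurve] at h2
  rw [liftDiff, liftDiff, star_sub, sub_add_sub_comm, h1, h2, sub_self]

lemma liftDiff_unitary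
    (hu : IsPluriharmonicFreeOn annulus u)
    (hc : ∀ ρ : ℝ, 0 ≤ ρ → ρ < 2 → Summable fun k => ‖c k‖ * ρ ^ k.natAbs)
    (hφ : ∀ z : ℂ, 1 / 2 < ‖z‖ → ‖z‖ < 2 →
      HasSum (fun k => z ^ k • c k) (holoLift u 1 (Matrix.diagonal fun _ => z) 0 0))
    {N : Matrix (Fin n) (Fin n) ℂ} (hN : N ∈ Matrix.unitaryGroup (Fin n) ℂ) (i j : Fin n) :
    liftDiff u c N i j = liftDiff u c 1 i j := by
  obtain ⟨V, hV, θ, hVN⟩ := exists_unitary_eq_diagConj hN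
  have hlog : 0 < Real.log 2 := Real.log_pos (by norm_num)
  -- Any width in `(0, log 2)` works: the strip only has to contain `i` and `0`, where the curve
  -- takes the values `N` and `1`.
  have hρ : Real.log 2 / 2 < Real.log 2 := by linarith
  have hmem : ∀ z : ℂ, z.re = 0 → z ∈ strip θ (Real.log 2 / 2) := fun z hz i => by
    rw [hz, zero_mul, abs_zero]
    positivity
  have hconst := (isOpen_strip θ (Real.log 2 / 2)).is_const_of_deriv_eq_zero
    (isPreconnected_strip _ _) (differentiableOn_liftDiff hu hc hV hV hρ i j)
    (fun z hz => deriv_eq_zero_of_add_star_eq_zero (isOpen_strip _ _)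
      (differentiableOn_liftDiff hu hc hV hV hρ i j) (differentiableOn_liftDiff hu hc hV hV hρ j i)
      (fun z hz => liftDiff_add_star hu hc hφ hV hρ hz i j) hz)
    (hmem Complex.I Complex.I_re) (hmem 0 Complex.zero_re)
  have h0 : expCurve V V θ 0 = 1 := by
    rw [expCurve, ← diagConj_one hV]
    congr 1
    funext i
    simp
  rw [hVN, ← h0]
  exact hconst

lemma liftDiff_eq
    (hu : IsPluriharmonicFreeOn annulus u)
    (hc : ∀ ρ : ℝ, 0 ≤ ρ → ρ < 2 → Summable fun k => ‖c k‖ * ρ ^ k.natAbs)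
    (hφ : ∀ z : ℂ, 1 / 2 < ‖z‖ → ‖z‖ < 2 →
      HasSum (fun k => z ^ k • c k) (holoLift u 1 (Matrix.diagonal fun _ => z) 0 0))
    {X : Matrix (Fin n) (Fin n) ℂ} (hX : X ∈ annulus n) (i j : Fin n) :
    liftDiff u c X i j = liftDiff u c 1 i j := by
  obtain ⟨W, hW, V, hV, b, hb, hXb⟩ := exists_svd hX
  have hlog : 0 < Real.log 2 := Real.log_pos (by norm_num)
  -- The strict inequalities `|b i| < log 2` leave room for a `ρ` whose strip contains `z = 1`, the
  -- parameter of `X`.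
  obtain ⟨ρ, hρ, hρ0, hbρ⟩ : ∃ ρ, ρ < Real.log 2 ∧ 0 < ρ ∧ ∀ i, |b i| < ρ := by
    have h1 : ∀ᶠ ρ in nhdsWithin (Real.log 2) (Set.Iio (Real.log 2)), ∀ i, |b i| < ρ :=
      Filter.eventually_all.2 fun i => nhdsWithin_le_nhds (lt_mem_nhds (hb i))
    have h2 : ∀ᶠ ρ in nhdsWithin (Real.log 2) (Set.Iio (Real.log 2)), 0 < ρ :=
      nhdsWithin_le_nhds (lt_mem_nhds hlog)
    obtain ⟨ρ, h1, h2, h3⟩ := (h1.and (h2.and self_mem_nhdsWithin)).exists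
    exact ⟨ρ, h3, h2, h1⟩
  have hunit : ∀ t : ℝ, expCurve W V b (t * Complex.I) ∈ Matrix.unitaryGroup (Fin n) ℂ := by
    intro t
    refine mul_mem (mul_mem hW ?_) (Unitary.star_mem hV)
    rw [Matrix.mem_unitaryGroup_iff, Matrix.star_eq_conjTranspose, Matrix.diagonal_conjTranspose,
      Matrix.diagonal_mul_diagonal, ← Matrix.diagonal_one]
    congr 1
    funext i
    rw [Pi.star_apply, Complex.star_def, ← Complex.exp_conj, ← Complex.exp_add]
    simp
  have hone : (1 : ℂ) ∈ strip b ρ := fun i => by simpa using hbρ i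
  have := eqOn_strip_of_imaginary hρ0
    ((differentiableOn_liftDiff hu hc hW hV hρ i j).sub_const (liftDiff u c 1 i j))
    (fun t => sub_eq_zero.2 (liftDiff_unitary hu hc hφ (hunit t) i j)) hone
  have h1 : expCurve W V b 1 = X := by
    rw [hXb, expCurve]
    simp
  rw [← h1]
  exact sub_eq_zero.1 this

end Main

end FreeNC

theorem mainTheorem8 {R : Type*} [NormedAddCommGroup R] [NormedSpace ℂ R] [CompleteSpace R]
    [StarAddMonoid R] [StarModule ℂ R] [ContinuousStar R]
    (u : FreeNC.GradedFun R) (hu : FreeNC.IsPluriharmonicFreeOn FreeNC.annulus u) :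
    ∃ c : ℤ → R, ∀ (n : ℕ), ∀ X ∈ FreeNC.annulus n,
      ∃ S : Matrix (Fin n) (Fin n) R,
        HasSum (fun k : ℤ => FreeNC.coeffMul (c k) (X ^ k)) S ∧
          u n X = ((realPart S : selfAdjoint (Matrix (Fin n) (Fin n) R)) :
            Matrix (Fin n) (Fin n) R) := by
  obtain ⟨c, hc, hφ⟩ := FreeNC.exists_laurent_coeff hu
  refine ⟨c, fun n X hX => ⟨FreeNC.laurentSum c X, FreeNC.hasSum_coeffMul hc hX, ?_⟩⟩
  ext i j
  have h1 := FreeNC.holoLift_add_star hu hX i j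
  have h2 : FreeNC.liftDiff u c X i j + star (FreeNC.liftDiff u c X j i) = 0 := by
    -- The constant curve, with exponents `0`, gives `h(1) + h(1)* = 0`; constancy of `h` carries
    -- this to `X`.
    have hz : (0 : ℂ) ∈ FreeNC.strip (0 : Fin n → ℝ) (Real.log 2 / 2) := fun i => by
      have : 0 < Real.log 2 := Real.log_pos (by norm_num)
      simpa using this
    have := FreeNC.liftDiff_add_star hu hc hφ (one_mem (Matrix.unitaryGroup (Fin n) ℂ))
      (half_lt_self (Real.log_pos (by norm_num))) hz i j
    have h1 : FreeNC.expCurve (1 : Matrix (Fin n) (Fin n) ℂ) 1 0 0 = 1 := by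
      simp [FreeNC.expCurve, FreeNC.diagConj]
    rw [h1] at this
    rwa [FreeNC.liftDiff_eq hu hc hφ hX, FreeNC.liftDiff_eq hu hc hφ hX]
  rw [FreeNC.liftDiff, FreeNC.liftDiff, star_sub, sub_add_sub_comm, h1, sub_eq_zero] at h2
  rw [realPart_apply_coe, Matrix.smul_apply, Matrix.add_apply, Matrix.star_apply, ← h2,
    ← two_smul ℝ, smul_smul]
  norm_num
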